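/- Let $m\ge 1$, let $e\ge 4$, and let $\kappa$ be an even integer with $2\le\kappa\le e$. Let $R$ be a finite commutative chain ring whose maximal ideal $\langle u\rangle$ has nilpotency index $e$, whose residue field $K=R/\langle u\rangle$ has order $2^m$, and in which $\langle 2\rangle=\langle u^{\kappa}\rangle$ (that is, $2\in\langle u^\kappa\rangle\setminus\langle u^{\kappa+1}\rangle$ if $\kappa<e$, and $2=0$ if $\kappa=e$). Put $s=\lfloor e/2\rfloor$, $\theta_e=0$ if $e$ is even and $\theta_e=1$ if $e$ is odd, $\kappa_1=\kappa/2$, and, for a prime power $q$, ${b\brack d}_q=\prod_{i=0}^{d-1}\frac{q^b-q^i}{q^d-q^i}$. A linear code of length $n$ over $R$ (or over $K$) is a submodule of $R^n$ (of $K^n$); it is self-orthogonal if $\mathbf c\cdot\mathbf d=\sum_i c_id_i=0$ for all its elements $\mathbf c,\mathbf d$. A linear code over $R$ is of type $\{\lambda_1,\ldots,\lambda_e\}$ if, after a permutation of the coordinates, it is generated by the rows of a matrix with $e$ blocks of rows, of sizes $\lambda_1,\ldots,\lambda_e$, and $e+1$ blocks of columns, of sizes $\lambda_1,\ldots,\lambda_{e+1}$,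 where $\lambda_{e+1}=n-(\lambda_1+\cdots+\lambda_e)$, whose $i$-th block of rows is $u^{i-1}\begin{bmatrix}0&\cdots&0&I_{\lambda_i}&A_{i,i}&\cdots&A_{i,e}\end{bmatrix}$, the identity matrix $I_{\lambda_i}$ standing in the $i$-th block of columns. Let $n$ be odd, and let $\lambda_1,\ldots,\lambda_{e+1}$ be non-negative integers with $\lambda_1+\cdots+\lambda_{e+1}=n$ and $$2\lambda_1+\cdots+2\lambda_{e-i+1}+\lambda_{e-i+2}+\cdots+\lambda_i\le n\qquad\text{for } s+1\le i\le e.$$ Put $\Lambda_0=0$ and $\Lambda_i=\lambda_1+\cdots+\lambda_i$. Then the number $\mathscr M_e(n;\lambda_1,\ldots,\lambda_e)$ of self-orthogonal codes of type $\{\lambda_1,\ldots,\lambda_e\}$ and length $n$ over $R$ is $$\mathscr M_e(n;\lambda_1,\ldots,\lambda_e)=(2^m)^{E}\;\mathfrak B(\lambda_1,\ldots,\lambda_{s+\theta_e})\prod_{a=s+1+\theta_e}^{e}{\lambda_a+n-\Lambda_a-\Lambda_{e+1-a}\brack\lambda_a}_{2^m},$$ where $$E=\sum_{i=1}^{s}\Lambda_i(n-\Lambda_{i+1})+\sum_{j=1}^{s-1+\theta_e}\Lambda_{s+j}(n-\Lambda_{s+j+1}-\Lambda_{s-j+\theta_e})-\sum_{\ell=1}^{s-\kappa_1}\Lambda_\ell-(1-\theta_e)\frac{\Lambda_s(\Lambda_s-1)}2,$$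 and $\mathfrak B(\lambda_1,\ldots,\lambda_{s+\theta_e})$ is the number of chains $D^{(1)}\subseteq D^{(2)}\subseteq\cdots\subseteq D^{(s+\theta_e)}$ of self-orthogonal codes of length $n$ over $K$ with $\dim D^{(i)}=\Lambda_i$ for $1\le i\le s+\theta_e$ and $(1,\ldots,1)\notin D^{(s-\kappa_1)}$ (where $D^{(0)}=\{0\}$). Moreover $$\mathfrak B(\lambda_1,\ldots,\lambda_{s+\theta_e})=\prod_{i=0}^{\Lambda_{s+\theta_e}-1}\frac{2^{m(n-1-2i)}-1}{2^{m(i+1)}-1}\;\prod_{j=1}^{s+\theta_e}{\Lambda_j\brack\lambda_j}_{2^m}.$$ -/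

import Mathlib

open Matrix

namespace ChainRingCodes

/-- `R` is a finite commutative chain ring (its ideals form a chain under inclusion) with maximal
ideal `⟨u⟩` of nilpotency index `e`, residue field of order `2 ^ m`, and `⟨2⟩ = ⟨u ^ κ⟩`.

For `κ < e` the last condition says `2 ∈ ⟨u ^ κ⟩ \ ⟨u ^ (κ + 1)⟩`; for `κ = e` it says that `2 = 0`
in `R` (the case `R ≅ 𝔽_{2^m}[x] / ⟨x ^ e⟩`). -/
structure IsEvenChainRing (R : Type*) [CommRing R] [IsLocalRing R] (u : R) (e m κ : ℕ) : Prop where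
  finite : Finite R
  ideals_chain : ∀ I J : Ideal R, I ≤ J ∨ J ≤ I
  maximalIdeal_eq : IsLocalRing.maximalIdeal R = Ideal.span {u}
  pow_eq_zero : u ^ e = 0
  pow_pred_ne_zero : u ^ (e - 1) ≠ 0
  card_residueField : Nat.card (IsLocalRing.ResidueField R) = 2 ^ m
  span_two : Ideal.span {(2 : R)} = Ideal.span {u ^ κ}

/-- `Λ_i = λ_1 + ⋯ + λ_i`, with `Λ_0 = 0`. -/
def partialSum (lam : ℕ → ℕ) (i : ℕ) : ℕ := ∑ j ∈ Finset.Icc 1 i, lam j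

/-- The Gaussian binomial coefficient `[b choose d]_q`. -/
def gaussBinom (q : ℚ) (b d : ℕ) : ℚ :=
  ∏ i ∈ Finset.range d, (q ^ b - q ^ i) / (q ^ d - q ^ i)

section Codes

variable {R : Type*} [CommRing R] {n : ℕ}

/-- The Euclidean dual code. -/
def dualCode (C : Submodule R (Fin n → R)) : Submodule R (Fin n → R) where
  carrier := {w | ∀ v ∈ C, v ⬝ᵥ w = 0}
  add_mem' := by
    intro a b ha hb v hv
    rw [dotProduct_add, ha v hv, hb v hv, add_zero]
  zero_mem' := by
    intro v _
    exact dotProduct_zero v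
  smul_mem' := by
    intro c a ha v hv
    rw [dotProduct_smul, ha v hv, smul_zero]

/-- A linear code contained in its Euclidean dual. -/
def IsSelfOrthogonal (C : Submodule R (Fin n → R)) : Prop := C ≤ dualCode C

/-- Two linear codes that differ by a permutation of the coordinate positions. -/
def IsPermEquiv (C C' : Submodule R (Fin n → R)) : Prop :=
  ∃ σ : Equiv.Perm (Fin n), C' = C.map (LinearMap.funLeft R R σ)

/-- When positions `0, 1, 2, …` are cut into consecutive blocks of sizes `λ_1, …, λ_e` (and a last
block), `blockIndex lam e c` is the number, counted from `0`, of the block that contains `c`: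
it equals `j < e` when `Λ_j ≤ c < Λ_{j+1}`, and `e` when `Λ_e ≤ c`. -/
def blockIndex (lam : ℕ → ℕ) (e c : ℕ) : ℕ :=
  ((Finset.Icc 1 e).filter fun i => partialSum lam i ≤ c).card

/-- Standard form of a generator matrix. Rows are grouped into blocks of sizes `λ_1, …, λ_e`,
columns into blocks of sizes `λ_1, …, λ_e, λ_{e+1}`. The `i`-th block of rows (`i = 1, …, e`) is
`u ^ (i - 1) • (0 ⋯ 0  I  A_{i,i} ⋯ A_{i,e})`, the identity standing in the `i`-th block of columns.
Row operations with the blocks below change `A_{i,j}` by arbitrary multiples of `u ^ (j - i + 1)`, so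
the entries of `A_{i,j}` are not required to be reduced modulo `u ^ (j - i + 1)`. The rows are automatically a minimal generating set of their span when
`u` generates the maximal ideal and `u ^ (e - 1) ≠ 0`. -/
def IsStandardForm (u : R) (e : ℕ) (lam : ℕ → ℕ)
    (G : Matrix (Fin (partialSum lam e)) (Fin n) R) : Prop :=
  ∃ A : Matrix (Fin (partialSum lam e)) (Fin n) R,
    (∀ (r : Fin (partialSum lam e)) (c : Fin n), blockIndex lam e c < blockIndex lam e r →
      A r c = 0) ∧
    (∀ (r : Fin (partialSum lam e)) (c : Fin n), blockIndex lam e c = blockIndex lam e r →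
      A r c = if (c : ℕ) = (r : ℕ) then 1 else 0) ∧
    (∀ (r : Fin (partialSum lam e)) (c : Fin n), G r c = u ^ blockIndex lam e r * A r c)

/-- The linear code `C` is of type `{λ_1, …, λ_e}`: it is permutation equivalent to a code with a
generator matrix in standard form. -/
def IsOfType (u : R) (e : ℕ) (lam : ℕ → ℕ) (C : Submodule R (Fin n → R)) : Prop :=
  ∃ C' : Submodule R (Fin n → R), IsPermEquiv C C' ∧
    ∃ G : Matrix (Fin (partialSum lam e)) (Fin n) R,
      IsStandardForm u e lam G ∧ C' = Submodule.span R (Set.range fun r => G r)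

end Codes

/-- The number of self-orthogonal codes of type `{λ_1, …, λ_e}` and length `n` over `R`. -/
noncomputable def numSelfOrthogonal (R : Type*) [CommRing R] (u : R) (e n : ℕ) (lam : ℕ → ℕ) : ℕ :=
  Nat.card {C : Submodule R (Fin n → R) // IsSelfOrthogonal C ∧ IsOfType u e lam C}

/-- The number of chains `D_1 ⊆ ⋯ ⊆ D_k` of self-orthogonal codes of length `n` over the field `K`
with `dim D_i = Λ_i` for all `i` and with the all-one vector outside `D_t`. A term `D_0`, of
dimension `Λ_0 = 0`, is put in front, so that the condition also makes sense for `t = 0`. -/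
noncomputable def numChains (K : Type*) [Field K] (n : ℕ) (lam : ℕ → ℕ) (k t : ℕ) : ℕ :=
  Nat.card {D : Fin (k + 1) → Submodule K (Fin n → K) //
    Monotone D ∧
    (∀ i : Fin (k + 1), IsSelfOrthogonal (D i)) ∧
    (∀ i : Fin (k + 1), Module.finrank K (D i) = partialSum lam i) ∧
    (∀ i : Fin (k + 1), (i : ℕ) = t → (fun _ => (1 : K)) ∉ D i)}

/-- The exponent of `2 ^ m` in the enumeration formula, where `s = ⌊e/2⌋`, `θ = e mod 2` and
`κ₁ = κ/2`. The division by `2` is exact. -/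
def formulaExponent (e n κ : ℕ) (lam : ℕ → ℕ) : ℤ :=
  let s := e / 2
  let θ := e % 2
  let L : ℕ → ℤ := fun i => (partialSum lam i : ℤ)
  (∑ i ∈ Finset.Icc 1 s, L i * (n - L (i + 1)))
    + (∑ j ∈ Finset.Icc 1 (s - 1 + θ), L (s + j) * (n - L (s + j + 1) - L (s + θ - j)))
    - (∑ l ∈ Finset.Icc 1 (s - κ / 2), L l)
    - (1 - (θ : ℤ)) * (L s * (L s - 1) / 2)

end ChainRingCodes

/-!
The count is a double count of pairs of a self-orthogonal code and a sequence of generators of it.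
Write `q = 2 ^ m`, and let the row `r < Λ_e` have level `b r` (its block index, counted from `0`). A
generator sequence consists of vectors `v r` whose reductions over the residue field are linearly
independent and for which the vectors `u ^ b r • v r` are pairwise orthogonal and isotropic. It
generates a self-orthogonal code, and the `j`-th torsion code of this code (the reductions of the `v`
with `u ^ j • v` in the code) is spanned by the reductions of the `v r` of level at most `j`
(`torsionCode_generatedCode`). Since a code has type `lam` exactly when its torsion codes have the
dimensions `Λ_1, …, Λ_e` (`isOfType_iff`), every generator sequence generates a code of type `lam`,
and the sequences that generate a given code are counted by choosing a basis adapted to the torsion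
codes and then lifts within the code (`card_generators_of_code`).

All generator sequences are counted one vector at a time (`card_generatorSeq_extensions`). The
reductions at levels below `e / 2` form an isotropic sequence, exactly the data of an adapted basis of
a chain of self-orthogonal codes over the residue field, which is counted in the same way
(`numChains_mul`); those at higher levels give the Gaussian binomial coefficients. For a given
reduction, the orthogonality conditions to the earlier vectors are independent because the reductions
are, so the number of lifts is a power of `q` (`card_linear_conditions`).

The delicate condition is `u ^ f ∣ v ⬝ᵥ v` (`card_norm_condition`). Here
`v ⬝ᵥ v = x ^ 2 - 2 * y`, where `x` is the sum of the coordinates and `y` the second elementary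
symmetric function of them. The length is odd, so the all-one vector is not isotropic and is therefore
independent of every self-orthogonal code over the residue field. Consequently `x` and `y` vary
independently over their residue classes when `v` is moved along suitable dual vectors, and it remains
to count the pairs with `x ^ 2 ≡ 2 * y` modulo `u ^ f` (`card_square_pairs`), which uses that squaring
is bijective on a finite field of characteristic two.

The numbers of conditions add up to the exponent of the formula (`sum_exponents`), and the product for
the chains telescopes (`prod_flag`).
-/

namespace ChainRingCodes

/-! ### Counting lemmas -/

section Counting

/-- If `f` maps `P` into `T` with all fibres over `T` of size `c`, then `P` has `c` times as many
elements as `T`. -/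
theorem card_subtype_of_fibers {α β : Type*} [Finite α] [Finite β] (f : α → β) (P : α → Prop)
    (T : β → Prop) (hPT : ∀ a, P a → T (f a)) (c : ℕ)
    (h : ∀ b, T b → Nat.card {a // P a ∧ f a = b} = c) :
    Nat.card {a // P a} = Nat.card {b // T b} * c := by
  classical
  have := Fintype.ofFinite {b // T b}
  let g : {a // P a} → {b // T b} := fun a => ⟨f a, hPT a a.2⟩
  rw [← Nat.card_congr (Equiv.sigmaFiberEquiv g), Nat.card_sigma,
    Finset.sum_congr rfl (g := fun _ => c), Finset.sum_const, Finset.card_univ,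
    Nat.card_eq_fintype_card, smul_eq_mul]
  intro b _
  rw [← h b b.2]
  exact Nat.card_congr
    { toFun := fun a => ⟨a.1.1, a.1.2, congrArg Subtype.val a.2⟩
      invFun := fun a => ⟨⟨a.1, a.2.1⟩, Subtype.ext a.2.2⟩
      left_inv := fun _ => rfl
      right_inv := fun _ => rfl }

/-- Double counting along translations: if `S` is stable under the translations by `g i` and, for
each `v ∈ S`, exactly `c` of the translates of `v` satisfy `W`, then the proportion of elements of
`S` that satisfy `W` is `c / |ι|`. -/
theorem card_mul_card_of_translate {V ι : Type*} [AddCommGroup V] [Finite V] [Finite ι]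
    (g : ι → V) (S W : V → Prop) (hS : ∀ v i, S (v + g i) ↔ S v) (c : ℕ)
    (h : ∀ v, S v → Nat.card {i // W (v + g i)} = c) :
    Nat.card {v // S v ∧ W v} * Nat.card ι = Nat.card {v // S v} * c := by
  rw [← card_subtype_of_fibers (fun p : V × ι => p.1) (fun p => S p.1 ∧ W (p.1 + g p.2)) S
    (fun p hp => hp.1) c, ← Nat.card_prod]
  · exact Nat.card_congr
      { toFun := fun p => ⟨(p.1.1 - g p.2, p.2), by
          have := hS (p.1.1 - g p.2) p.2
          rw [sub_add_cancel] at this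
          exact ⟨this.1 p.1.2.1, by simpa using p.1.2.2⟩⟩
        invFun := fun p => (⟨p.1.1 + g p.1.2, (hS _ _).2 p.2.1, p.2.2⟩, p.1.2)
        left_inv := fun p => by simp
        right_inv := fun p => by simp }
  · intro v hv
    rw [← h v hv]
    exact Nat.card_congr
      { toFun := fun p => ⟨p.1.2, by have := p.2.1.2; rw [p.2.2] at this; exact this⟩
        invFun := fun i => ⟨(v, i.1), ⟨hv, i.2⟩, rfl⟩
        left_inv := by rintro ⟨⟨a, b⟩, h1, h2⟩; simp at h2; subst h2; rfl
        right_inv := fun _ => rfl }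

theorem card_addSubgroup_eq_map_mul_ker {G H : Type*} [AddCommGroup G] [AddCommGroup H]
    (A : AddSubgroup G) (f : G →+ H) :
    Nat.card A = Nat.card (A.map f) * Nat.card (A ⊓ f.ker : AddSubgroup G) := by
  have h1 := AddSubgroup.card_mul_index (f.comp A.subtype).ker
  rw [AddSubgroup.index_ker, AddMonoidHom.range_comp, AddSubgroup.range_subtype] at h1
  rw [← h1, mul_comm]
  congr 1
  exact Nat.card_congr
    { toFun := fun a => ⟨a.1.1, a.1.2, a.2⟩
      invFun := fun a => ⟨⟨a.1, a.2.1⟩, a.2.2⟩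
      left_inv := fun _ => rfl
      right_inv := fun _ => rfl }

/-- If a family of predicates on finite sequences is closed under initial segments and each good
sequence of length `r` has exactly `N r` good extensions, the number of good sequences of length `k`
is `∏ r < k, N r`. -/
theorem card_sequences {α : Type*} [Finite α] (P : (r : ℕ) → (Fin r → α) → Prop) (N : ℕ → ℚ)
    (k : ℕ) (h0 : ∀ x, P 0 x)
    (hstep : ∀ r < k, ∀ (x : Fin r → α) (a : α), P (r + 1) (Fin.snoc x a) → P r x)
    (hcard : ∀ r < k, ∀ x : Fin r → α, P r x →
      (Nat.card {a // P (r + 1) (Fin.snoc x a)} : ℚ) = N r) :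
    (Nat.card {x : Fin k → α // P k x} : ℚ) = ∏ r ∈ Finset.range k, N r := by
  classical
  induction k with
  | zero =>
    have : Nat.card {x : Fin 0 → α // P 0 x} = 1 := by
      rw [Nat.card_eq_one_iff_unique]
      exact ⟨⟨fun a b => Subtype.ext (Subsingleton.elim _ _)⟩, ⟨⟨Fin.elim0, h0 _⟩⟩⟩
    rw [this, Finset.range_zero, Finset.prod_empty, Nat.cast_one]
  | succ k ih =>
    have ih := ih (fun r hr => hstep r (hr.trans k.lt_succ_self))
      (fun r hr => hcard r (hr.trans k.lt_succ_self))
    have := Fintype.ofFinite {x : Fin k → α // P k x}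
    have e : {x : Fin (k + 1) → α // P (k + 1) x} ≃
        Σ x : {x : Fin k → α // P k x}, {a // P (k + 1) (Fin.snoc x.1 a)} :=
      { toFun := fun x => ⟨⟨Fin.init x.1, hstep k k.lt_succ_self _ (x.1 (Fin.last k)) (by
            rw [Fin.snoc_init_self]; exact x.2)⟩, ⟨x.1 (Fin.last k), by
            rw [Fin.snoc_init_self]; exact x.2⟩⟩
        invFun := fun y => ⟨Fin.snoc y.1.1 y.2.1, y.2.2⟩
        left_inv := fun x => Subtype.ext (Fin.snoc_init_self _)
        right_inv := by
          rintro ⟨⟨x, hx⟩, ⟨a, ha⟩⟩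
          simp only
          congr 1
          · simp
          · congr 1
            · simp
            · simp
            · apply proof_irrel_heq }
    rw [Nat.card_congr e, Nat.card_sigma, Nat.cast_sum,
      Finset.sum_congr rfl (fun x _ => hcard k k.lt_succ_self x.1 x.2), Finset.sum_const,
      Finset.card_univ, Finset.prod_range_succ, ← ih, Nat.card_eq_fintype_card, nsmul_eq_mul]

end Counting

/-! ### Arithmetic of the chain ring -/

namespace IsEvenChainRing

variable {R : Type*} [CommRing R] [IsLocalRing R] {u : R} {e m κ : ℕ}

theorem residue_eq_zero_iff (hR : IsEvenChainRing R u e m κ) {x : R} :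
    IsLocalRing.residue R x = 0 ↔ u ∣ x := by
  rw [IsLocalRing.residue_eq_zero_iff, hR.maximalIdeal_eq, Ideal.mem_span_singleton]

theorem residue_eq_iff (hR : IsEvenChainRing R u e m κ) {x y : R} :
    IsLocalRing.residue R x = IsLocalRing.residue R y ↔ u ∣ x - y := by
  rw [← hR.residue_eq_zero_iff, map_sub, sub_eq_zero]

theorem isUnit_of_not_dvd (hR : IsEvenChainRing R u e m κ) {x : R} (hx : ¬ u ∣ x) : IsUnit x := by
  by_contra h
  apply hx
  rw [← Ideal.mem_span_singleton, ← hR.maximalIdeal_eq]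
  exact h

theorem not_isUnit_of_dvd (hR : IsEvenChainRing R u e m κ) {x : R} (hx : u ∣ x) : ¬ IsUnit x := by
  rw [← Ideal.mem_span_singleton, ← hR.maximalIdeal_eq] at hx
  exact hx

theorem e_pos (hR : IsEvenChainRing R u e m κ) : 0 < e := by
  rcases Nat.eq_zero_or_pos e with h | h
  · have h1 := hR.pow_eq_zero
    have h2 := hR.pow_pred_ne_zero
    subst h
    exact absurd h1 h2
  · exact h

theorem pow_ne_zero (hR : IsEvenChainRing R u e m κ) {j : ℕ} (hj : j < e) : u ^ j ≠ 0 := by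
  intro h
  apply hR.pow_pred_ne_zero
  rw [show e - 1 = j + (e - 1 - j) by omega, pow_add, h, zero_mul]

/-- The annihilator of `u ^ j` is the ideal generated by `u ^ (e - j)`. -/
theorem pow_mul_eq_zero_iff (hR : IsEvenChainRing R u e m κ) {j : ℕ} (hj : j ≤ e) {y : R} :
    u ^ j * y = 0 ↔ u ^ (e - j) ∣ y := by
  constructor
  · intro h
    have key : ∀ k ≤ e - j, u ^ k ∣ y := by
      intro k
      induction k with
      | zero => intro _; simp
      | succ k ih =>
        intro hk
        obtain ⟨z, rfl⟩ := ih (by omega)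
        have hz : u ∣ z := by
          by_contra hz
          have hz := hR.isUnit_of_not_dvd hz
          rw [← mul_assoc, ← pow_add, hz.mul_left_eq_zero] at h
          exact hR.pow_ne_zero (by omega) h
        rw [pow_succ]
        exact mul_dvd_mul_left _ hz
    exact key _ le_rfl
  · rintro ⟨z, rfl⟩
    rw [← mul_assoc, ← pow_add, show j + (e - j) = e by omega, hR.pow_eq_zero, zero_mul]

theorem dvd_of_pow_mul_dvd (hR : IsEvenChainRing R u e m κ) {i j : ℕ} (hij : i + j ≤ e) {y : R}
    (h : u ^ (i + j) ∣ u ^ i * y) : u ^ j ∣ y := by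
  obtain ⟨z, hz⟩ := h
  have h1 : u ^ i * (y - u ^ j * z) = 0 := by rw [mul_sub, hz]; ring
  rw [hR.pow_mul_eq_zero_iff (by omega)] at h1
  have h2 : u ^ j ∣ y - u ^ j * z := (pow_dvd_pow u (by omega)).trans h1
  simpa using dvd_add h2 (dvd_mul_right (u ^ j) z)

theorem dvd_of_pow_dvd_sq (hR : IsEvenChainRing R u e m κ) {f : ℕ} (hf : f ≤ e) {x : R}
    (h : u ^ f ∣ x ^ 2) : ∀ a, 2 * a ≤ f + 1 → u ^ a ∣ x := by
  intro a
  induction a with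
  | zero => simp
  | succ a ih =>
    intro ha
    obtain ⟨z, rfl⟩ := ih (by omega)
    rw [pow_succ]
    apply mul_dvd_mul_left
    by_contra hz
    have hz := (hR.isUnit_of_not_dvd hz).pow 2
    have h1 : u ^ (2 * a + 1) ∣ u ^ (2 * a) * z ^ 2 := by
      refine (pow_dvd_pow u (show 2 * a + 1 ≤ f by omega)).trans (h.trans (dvd_of_eq ?_))
      ring
    have h2 := hR.dvd_of_pow_mul_dvd (by omega) h1
    rw [pow_one] at h2
    exact hR.not_isUnit_of_dvd h2 hz

/-- Generators of the same principal ideal of a local ring are associated, also when they are zero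
divisors. -/
theorem two_eq (hR : IsEvenChainRing R u e m κ) : ∃ ε : R, IsUnit ε ∧ u ^ κ = ε * 2 := by
  have h := hR.span_two
  have h1 : (2 : R) ∈ Ideal.span {u ^ κ} := h ▸ Ideal.mem_span_singleton_self _
  have h2 : u ^ κ ∈ Ideal.span {(2 : R)} := h ▸ Ideal.mem_span_singleton_self _
  obtain ⟨a, ha⟩ := Ideal.mem_span_singleton.1 h1
  obtain ⟨b, hb⟩ := Ideal.mem_span_singleton.1 h2
  have h3 : u ^ κ * (1 - a * b) = 0 := by
    rw [mul_sub, ← mul_assoc, ← ha, ← hb]; ring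
  by_cases hab : IsUnit (a * b)
  · exact ⟨b, isUnit_of_mul_isUnit_right hab, by rw [hb, mul_comm]⟩
  · have : IsUnit (1 - a * b) := by
      rcases IsLocalRing.isUnit_or_isUnit_of_add_one (a := 1 - a * b) (b := a * b) (by ring) with
        h | h
      · exact h
      · exact absurd h hab
    rw [this.mul_left_eq_zero] at h3
    exact ⟨1, isUnit_one, by rw [ha, h3]; ring⟩

theorem dvd_two (hR : IsEvenChainRing R u e m κ) (hκ : κ ≠ 0) : u ∣ (2 : R) := by
  have h1 : (2 : R) ∈ Ideal.span {u ^ κ} := hR.span_two ▸ Ideal.mem_span_singleton_self _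
  exact (dvd_pow_self u hκ).trans (Ideal.mem_span_singleton.1 h1)

theorem residue_two (hR : IsEvenChainRing R u e m κ) (hκ : κ ≠ 0) :
    (2 : IsLocalRing.ResidueField R) = 0 := by
  rw [← hR.residue_eq_zero_iff.2 (hR.dvd_two hκ), map_ofNat]

theorem finite_residueField (hR : IsEvenChainRing R u e m κ) :
    Finite (IsLocalRing.ResidueField R) :=
  have := hR.finite
  Finite.of_surjective _ IsLocalRing.residue_surjective

theorem card_pow_dvd (hR : IsEvenChainRing R u e m κ) {j : ℕ} (hj : j ≤ e) :
    Nat.card {y : R // u ^ j ∣ y} = (2 ^ m) ^ (e - j) := by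
  have := hR.finite
  let A : ℕ → AddSubgroup R := fun j => (Ideal.span {u ^ j}).toAddSubgroup
  have memA : ∀ j y, y ∈ A j ↔ u ^ j ∣ y := fun j y => Ideal.mem_span_singleton
  have cardA : ∀ j, Nat.card {y : R // u ^ j ∣ y} = Nat.card (A j) := fun j =>
    Nat.card_congr (Equiv.subtypeEquivRight fun y => (memA j y).symm)
  -- the last nonzero power of the maximal ideal is a line over the residue field
  have hlast : Nat.card (A (e - 1)) = 2 ^ m := by
    have hk : (AddMonoidHom.mulLeft (u ^ (e - 1))).ker =
        (IsLocalRing.residue R).toAddMonoidHom.ker := by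
      ext y
      have : u ^ (e - 1) * y = 0 ↔ IsLocalRing.residue R y = 0 := by
        rw [hR.pow_mul_eq_zero_iff (by omega), hR.residue_eq_zero_iff,
          show e - (e - 1) = 1 by have := hR.e_pos; omega, pow_one]
      exact this
    have h3 := congrArg AddSubgroup.index hk
    rw [AddSubgroup.index_ker, AddSubgroup.index_ker,
      AddMonoidHom.range_eq_top_of_surjective (IsLocalRing.residue R).toAddMonoidHom
        IsLocalRing.residue_surjective,
      Nat.card_congr AddSubgroup.topEquiv.toEquiv, hR.card_residueField] at h3
    rw [← h3]
    apply Nat.card_congr (Equiv.subtypeEquivRight fun y => ?_)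
    rw [memA]
    exact ⟨fun ⟨z, hz⟩ => ⟨z, hz.symm⟩, fun ⟨z, hz⟩ => ⟨z, hz.symm⟩⟩
  rw [cardA]
  obtain ⟨i, rfl⟩ : ∃ i, j = e - i := ⟨e - j, by omega⟩
  induction i with
  | zero =>
    have : A (e - 0) = ⊥ := by
      ext y
      rw [memA, Nat.sub_zero, hR.pow_eq_zero, zero_dvd_iff]; rfl
    rw [this]; simp
  | succ i ih =>
    by_cases hi : i + 1 ≤ e
    · have h1 := card_addSubgroup_eq_map_mul_ker (A (e - (i + 1))) (AddMonoidHom.mulLeft u)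
      have h2 : (A (e - (i + 1))).map (AddMonoidHom.mulLeft u) = A (e - i) := by
        ext y
        rw [memA, show e - i = e - (i + 1) + 1 by omega, pow_succ']
        constructor
        · rintro ⟨z, hz, rfl⟩
          exact mul_dvd_mul_left u ((memA _ _).1 hz)
        · rintro ⟨z, rfl⟩
          exact ⟨u ^ (e - (i + 1)) * z, (memA _ _).2 (dvd_mul_right _ _), by
            simp [mul_assoc]⟩
      have h3 : (A (e - (i + 1)) ⊓ (AddMonoidHom.mulLeft u).ker : AddSubgroup R) = A (e - 1) := by
        ext y
        have : u * y = 0 ↔ u ^ (e - 1) ∣ y := by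
          have := hR.pow_mul_eq_zero_iff (j := 1) hR.e_pos (y := y)
          rwa [pow_one] at this
        rw [AddSubgroup.mem_inf, memA, memA, ← this]
        constructor
        · exact fun h => h.2
        · exact fun h => ⟨(pow_dvd_pow u (by omega)).trans (this.1 h), h⟩
      rw [h1, h2, h3, hlast, ih (by omega), ← pow_succ]
      congr 1; omega
    · have h4 : e - (i + 1) = e - i := by omega
      rw [h4]; exact ih (by omega)

theorem card_dvd_shift (hR : IsEvenChainRing R u e m κ) {j : ℕ} (hj : j ≤ e) (a : R) :
    Nat.card {y : R // u ^ j ∣ a + y} = (2 ^ m) ^ (e - j) := by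
  rw [← hR.card_pow_dvd hj]
  exact Nat.card_congr ((Equiv.addLeft a).subtypeEquiv fun y => by simp)

end IsEvenChainRing
/-! ### Reduction modulo the maximal ideal and dual systems -/

section Reduction

variable {R : Type*} [CommRing R] [IsLocalRing R] {n : ℕ}

/-- Coordinatewise reduction of a vector modulo the maximal ideal. -/
noncomputable def red (v : Fin n → R) : Fin n → IsLocalRing.ResidueField R := IsLocalRing.residue R ∘ v

theorem red_apply (v : Fin n → R) (i : Fin n) : red v i = IsLocalRing.residue R (v i) := rfl

theorem red_add (v w : Fin n → R) : red (v + w) = red v + red w := by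
  ext i; simp [red_apply]

theorem red_sub (v w : Fin n → R) : red (v - w) = red v - red w := by
  ext i; simp [red_apply]

theorem red_smul (r : R) (v : Fin n → R) : red (r • v) = IsLocalRing.residue R r • red v := by
  ext i; simp [red_apply]

theorem red_zero : red (0 : Fin n → R) = 0 := by
  ext i; simp [red_apply]

theorem red_one : red (1 : Fin n → R) = 1 := by
  ext i; simp [red_apply]

theorem red_sum {ι : Type*} (s : Finset ι) (f : ι → Fin n → R) :
    red (∑ i ∈ s, f i) = ∑ i ∈ s, red (f i) := by
  ext j; simp [red_apply, Finset.sum_apply]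

theorem red_surjective : Function.Surjective (red : (Fin n → R) → _) := fun x => by
  choose v hv using fun i => IsLocalRing.residue_surjective (x i)
  exact ⟨v, funext hv⟩

theorem residue_dotProduct (v w : Fin n → R) :
    IsLocalRing.residue R (v ⬝ᵥ w) = red v ⬝ᵥ red w :=
  RingHom.map_dotProduct _ _ _

/-- Vectors whose reductions are linearly independent have a dual system: a right inverse of their
matrix modulo the maximal ideal lifts, because a matrix with invertible reduction is invertible. -/
theorem exists_dual {ι : Type*} [Fintype ι] [DecidableEq ι] (a : ι → Fin n → R)
    (ha : LinearIndependent (IsLocalRing.ResidueField R) fun i => red (a i)) :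
    ∃ w : ι → Fin n → R, ∀ i j, a i ⬝ᵥ w j = if i = j then 1 else 0 := by
  let A : Matrix ι (Fin n) R := Matrix.of a
  let A' : Matrix ι (Fin n) (IsLocalRing.ResidueField R) := A.map (IsLocalRing.residue R)
  have hrank : A'.rank = Fintype.card ι := LinearIndependent.rank_matrix (M := A') ha
  have hsurj : Function.Surjective A'.mulVec := by
    have : LinearMap.range A'.mulVecLin = ⊤ := by
      apply Submodule.eq_top_of_finrank_eq
      rw [Module.finrank_pi]
      exact hrank
    exact LinearMap.range_eq_top.1 this
  obtain ⟨B', hB'⟩ := Matrix.mulVec_surjective_iff_exists_right_inverse.1 hsurj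
  choose B hB using fun i j => IsLocalRing.residue_surjective (B' i j)
  let B : Matrix (Fin n) ι R := Matrix.of B
  have hBB : B.map (IsLocalRing.residue R) = B' := by
    ext i j; exact hB i j
  have hdet : IsUnit (A * B).det := by
    rw [← isUnit_map_iff (IsLocalRing.residue R), RingHom.map_det, RingHom.mapMatrix_apply,
      Matrix.map_mul, hBB]
    change IsUnit (A' * B').det
    rw [hB', Matrix.det_one]
    exact isUnit_one
  have hC : A * (B * (A * B)⁻¹) = 1 := by
    rw [← Matrix.mul_assoc, Matrix.mul_nonsing_inv _ hdet]
  refine ⟨fun j i => (B * (A * B)⁻¹) i j, fun i j => ?_⟩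
  have := congrFun (congrFun hC i) j
  rw [Matrix.mul_apply, Matrix.one_apply] at this
  exact this

end Reduction

/-! ### The second elementary symmetric function -/

section PairSum

variable {R : Type*} [CommRing R] {n : ℕ}

/-- The sum of the products `v i * w j` over the pairs `i < j`. -/
def upperForm (v w : Fin n → R) : R := ∑ i, ∑ j, if i < j then v i * w j else 0

theorem upperForm_add_swap (v w : Fin n → R) :
    upperForm v w + upperForm w v = (1 ⬝ᵥ v) * (1 ⬝ᵥ w) - v ⬝ᵥ w := by
  have h1 : upperForm w v = ∑ i, ∑ j, if j < i then v i * w j else 0 := by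
    rw [upperForm, Finset.sum_comm]
    refine Finset.sum_congr rfl fun i _ => Finset.sum_congr rfl fun j _ => ?_
    split_ifs <;> ring
  have h2 : v ⬝ᵥ w = ∑ i, ∑ j, if i = j then v i * w j else 0 := by
    simp [dotProduct]
  rw [eq_sub_iff_add_eq, h1, h2, one_dotProduct, one_dotProduct, Finset.sum_mul_sum, upperForm,
    ← Finset.sum_add_distrib, ← Finset.sum_add_distrib]
  refine Finset.sum_congr rfl fun i _ => ?_
  rw [← Finset.sum_add_distrib, ← Finset.sum_add_distrib]
  refine Finset.sum_congr rfl fun j _ => ?_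
  rcases lt_trichotomy i j with h | h | h
  · simp [h, h.ne, h.not_gt]
  · simp [h]
  · simp [h, h.ne', h.not_gt]

/-- The second elementary symmetric function of the coordinates of `v`. It refines half of
`(∑ v i) ^ 2 - v ⬝ᵥ v` over rings in which `2` is not invertible. -/
def pairSum (v : Fin n → R) : R := upperForm v v

theorem dotProduct_self_eq (v : Fin n → R) : v ⬝ᵥ v = (1 ⬝ᵥ v) ^ 2 - 2 * pairSum v := by
  have := upperForm_add_swap v v
  rw [pairSum]
  linear_combination this

theorem pairSum_add (v w : Fin n → R) :
    pairSum (v + w) = pairSum v + pairSum w + ((1 ⬝ᵥ v) * (1 ⬝ᵥ w) - v ⬝ᵥ w) := by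
  rw [← upperForm_add_swap]
  simp only [pairSum, upperForm, ← Finset.sum_add_distrib]
  refine Finset.sum_congr rfl fun i _ => Finset.sum_congr rfl fun j _ => ?_
  split_ifs
  · simp only [Pi.add_apply]; ring
  · simp

theorem pairSum_smul (r : R) (w : Fin n → R) : pairSum (r • w) = r ^ 2 * pairSum w := by
  simp only [pairSum, upperForm, Finset.mul_sum]
  refine Finset.sum_congr rfl fun i _ => Finset.sum_congr rfl fun j _ => ?_
  split_ifs
  · simp only [Pi.smul_apply, smul_eq_mul]; ring
  · simp

end PairSum

/-! ### Counting lifts under linear and norm conditions -/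

section Counting

variable {R : Type*} [CommRing R] [IsLocalRing R] {u : R} {e m κ : ℕ} {n : ℕ}

theorem IsEvenChainRing.red_eq_iff (hR : IsEvenChainRing R u e m κ) {v w : Fin n → R} :
    red v = red w ↔ ∀ i, u ∣ v i - w i := by
  rw [funext_iff]
  exact forall_congr' fun i => hR.residue_eq_iff

theorem IsEvenChainRing.residue_of_dvd (hR : IsEvenChainRing R u e m κ) {r : R} (hr : u ∣ r) :
    IsLocalRing.residue R r = 0 := hR.residue_eq_zero_iff.2 hr

theorem IsEvenChainRing.card_maximalIdeal (hR : IsEvenChainRing R u e m κ) :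
    Nat.card {r : R // u ∣ r} = (2 ^ m) ^ (e - 1) := by
  have := hR.card_pow_dvd (j := 1) hR.e_pos
  simpa using this

theorem IsEvenChainRing.card_red_eq (hR : IsEvenChainRing R u e m κ) (t : Fin n → R) :
    Nat.card {v : Fin n → R // red v = red t} = ((2 ^ m) ^ (e - 1)) ^ n := by
  have e1 : {v : Fin n → R // red v = red t} ≃ (Fin n → {r : R // u ∣ r}) :=
    { toFun := fun v i => ⟨v.1 i - t i, hR.red_eq_iff.1 v.2 i⟩
      invFun := fun r => ⟨fun i => r i + t i, hR.red_eq_iff.2 fun i => by simpa using (r i).2⟩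
      left_inv := fun v => by ext; simp
      right_inv := fun r => by ext; simp }
  rw [Nat.card_congr e1, Nat.card_pi]
  simp [hR.card_maximalIdeal]

/-- Linear conditions whose coefficient vectors have independent reductions are independent on every
residue class: `c j` counts the translates by the maximal ideal that meet the `j`-th condition. -/
theorem card_linear_conditions (hR : IsEvenChainRing R u e m κ) {ι : Type*} [Fintype ι]
    (a : ι → Fin n → R) (ha : LinearIndependent (IsLocalRing.ResidueField R) fun i => red (a i))
    (t : Fin n → R) (B : ι → R → Prop) (c : ι → ℕ)
    (hB : ∀ v, red v = red t → ∀ j, Nat.card {r : R // u ∣ r ∧ B j (a j ⬝ᵥ v + r)} = c j) :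
    Nat.card {v : Fin n → R // red v = red t ∧ ∀ j, B j (a j ⬝ᵥ v)} *
      ((2 ^ m) ^ (e - 1)) ^ Fintype.card ι = ((2 ^ m) ^ (e - 1)) ^ n * ∏ j, c j := by
  classical
  have := hR.finite
  obtain ⟨w, hw⟩ := exists_dual a ha
  have key := card_mul_card_of_translate (V := Fin n → R) (ι := ι → {r : R // u ∣ r})
    (fun r => ∑ j, (r j : R) • w j) (fun v => red v = red t) (fun v => ∀ j, B j (a j ⬝ᵥ v))
    (fun v r => by
      have : red (∑ j, (r j : R) • w j) = 0 := by
        rw [red_sum]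
        refine Finset.sum_eq_zero fun j _ => ?_
        rw [red_smul, hR.residue_of_dvd (r j).2, zero_smul]
      rw [red_add, this, add_zero]) (∏ j, c j) (by
    intro v hv
    have hdot : ∀ (r : ι → {r : R // u ∣ r}) (j : ι),
        a j ⬝ᵥ (v + ∑ j, (r j : R) • w j) = a j ⬝ᵥ v + r j := by
      intro r j
      rw [dotProduct_add, dotProduct_sum]
      simp [hw]
    simp only [hdot]
    rw [Nat.card_congr (Equiv.subtypePiEquivPi (p := fun j (r : {r : R // u ∣ r}) =>
      B j (a j ⬝ᵥ v + r))), Nat.card_pi]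
    refine Finset.prod_congr rfl fun j _ => ?_
    rw [← hB v hv j]
    exact Nat.card_congr (Equiv.subtypeSubtypeEquivSubtypeInter (fun r : R => u ∣ r)
      (fun r => B j (a j ⬝ᵥ v + r))))
  rw [Nat.card_pi, hR.card_red_eq] at key
  simpa [hR.card_maximalIdeal] using key

theorem IsEvenChainRing.card_annihilator_shift (hR : IsEvenChainRing R u e m κ) (k : ℕ) (y : R)
    (hy : k < e → u ∣ y) :
    Nat.card {r : R // u ∣ r ∧ u ^ k * (y + r) = 0} = (2 ^ m) ^ (min k (e - 1)) := by
  by_cases hk : k < e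
  · have h1 : e - (e - k) = min k (e - 1) := by omega
    rw [← h1, ← hR.card_dvd_shift (by omega) y]
    refine Nat.card_congr (Equiv.subtypeEquivRight fun r => ?_)
    rw [hR.pow_mul_eq_zero_iff hk.le]
    refine ⟨fun h => h.2, fun h => ⟨?_, h⟩⟩
    exact (dvd_add_right (hy hk)).1 ((dvd_pow_self u (by omega)).trans h)
  · have h1 : min k (e - 1) = e - 1 := by omega
    have h2 : u ^ k = 0 := by
      rw [show k = e + (k - e) by omega, pow_add, hR.pow_eq_zero, zero_mul]
    rw [h1, ← hR.card_maximalIdeal]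
    exact Nat.card_congr (Equiv.subtypeEquivRight fun r => by simp [h2])

theorem residue_pairSum (v : Fin n → R) : IsLocalRing.residue R (pairSum v) =
    ∑ i, ∑ j, if i < j then red v i * red v j else 0 := by
  simp only [pairSum, upperForm, map_sum, red_apply]
  refine Finset.sum_congr rfl fun i _ => Finset.sum_congr rfl fun j _ => ?_
  split_ifs <;> simp

/-- The number of independent conditions modulo the maximal ideal that `u ^ f ∣ v ⬝ᵥ v` imposes on a
vector `v` with prescribed isotropic reduction. -/
def normCodim (κ f : ℕ) : ℕ := (f - 1) / 2 + (f / 2 - κ / 2)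

/-- The pairs `(x, y)` of elements of the maximal ideal with `x ^ 2 ≡ 2 (c + y)` modulo `u ^ f`. For
`f ≤ κ` this only restricts `x`; for `f > κ` it forces `x = u ^ (κ / 2) * z`, prescribes `z` modulo
`u` (a square root of a residue), and then prescribes `y` modulo `u ^ (f - κ)`. -/
theorem card_square_pairs (hR : IsEvenChainRing R u e m κ) (hκ : 2 ≤ κ) (hκe : Even κ) {f : ℕ}
    (hf : 1 ≤ f) (hfe : f ≤ e) (c : R) :
    Nat.card {p : R × R // u ∣ p.1 ∧ u ∣ p.2 ∧ u ^ f ∣ p.1 ^ 2 - 2 * (c + p.2)} *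
      (2 ^ m) ^ normCodim κ f = (2 ^ m) ^ (2 * (e - 1)) := by
  have := hR.finite
  have := hR.finite_residueField
  obtain ⟨κ₁, rfl⟩ := hκe
  obtain ⟨ε, ⟨ε, rfl⟩, hε⟩ := hR.two_eq
  have h2 : (2 : R) = u ^ (κ₁ + κ₁) * ↑ε⁻¹ := by
    rw [hε, mul_comm, ← mul_assoc]; simp
  by_cases hfκ : f ≤ κ₁ + κ₁
  · have hdvd2 : u ^ f ∣ (2 : R) := (pow_dvd_pow u hfκ).trans ⟨_, h2⟩
    have e1 : {p : R × R // u ∣ p.1 ∧ u ∣ p.2 ∧ u ^ f ∣ p.1 ^ 2 - 2 * (c + p.2)} ≃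
        {x : R // u ^ ((f + 1) / 2) ∣ x} × {y : R // u ∣ y} :=
      (Equiv.subtypeEquivRight fun p => by
        rw [(dvd_sub_left (hdvd2.mul_right _))]
        constructor
        · rintro ⟨h1, h2, h3⟩
          exact ⟨hR.dvd_of_pow_dvd_sq hfe h3 _ (by omega), h2⟩
        · rintro ⟨h1, h2⟩
          refine ⟨(dvd_pow_self u (by omega)).trans h1, h2, ?_⟩
          refine Dvd.dvd.trans ?_ (pow_dvd_pow_of_dvd h1 2)
          rw [← pow_mul]
          exact pow_dvd_pow u (by omega)).trans Equiv.subtypeProdEquivProd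
    rw [Nat.card_congr e1, Nat.card_prod, hR.card_maximalIdeal, hR.card_pow_dvd (by omega),
      ← pow_add, ← pow_add, normCodim]
    congr 1
    omega
  · have hchar : ringChar (IsLocalRing.ResidueField R) = 2 := by
      apply CharP.ringChar_of_prime_eq_zero Nat.prime_two
      exact_mod_cast hR.residue_two (by omega)
    obtain ⟨s, hs⟩ := FiniteField.isSquare_of_char_two hchar
      (IsLocalRing.residue R (↑ε⁻¹ * c))
    obtain ⟨z₀, rfl⟩ := IsLocalRing.residue_surjective s
    have hcond : ∀ z y : R, u ^ f ∣ (u ^ κ₁ * z) ^ 2 - 2 * (c + y) ↔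
        u ^ (f - (κ₁ + κ₁)) ∣ (c - ε * z ^ 2) + y := by
      intro z y
      have h3 : (u ^ κ₁ * z) ^ 2 - 2 * (c + y) =
          u ^ (κ₁ + κ₁) * (-(↑ε⁻¹ * ((c - ε * z ^ 2) + y))) := by
        rw [h2]
        linear_combination (u ^ (κ₁ + κ₁) * z ^ 2 * (-1)) * (ε.inv_mul)
      rw [h3, show f = (κ₁ + κ₁) + (f - (κ₁ + κ₁)) by omega]
      constructor
      · intro h
        have h4 := hR.dvd_of_pow_mul_dvd (by omega) h
        rw [dvd_neg, ε⁻¹.isUnit.dvd_mul_left] at h4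
        rwa [show κ₁ + κ₁ + (f - (κ₁ + κ₁)) - (κ₁ + κ₁) = f - (κ₁ + κ₁) by omega]
      · intro h
        rw [show κ₁ + κ₁ + (f - (κ₁ + κ₁)) - (κ₁ + κ₁) = f - (κ₁ + κ₁) by omega] at h
        rw [pow_add]
        exact mul_dvd_mul_left _ ((dvd_neg).2 (h.mul_left _))
    have hz : ∀ z : R, u ∣ c - ε * z ^ 2 ↔ u ∣ z - z₀ := by
      intro z
      have h3 : c - ε * z ^ 2 = ε * (↑ε⁻¹ * c - z ^ 2) := by
        linear_combination (-c) * (ε.mul_inv)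
      rw [h3, ε.isUnit.dvd_mul_left, ← hR.residue_eq_iff, hs, ← hR.residue_eq_iff, map_pow, ← sq]
      constructor
      · intro h
        have h4 : (IsLocalRing.residue R z - IsLocalRing.residue R z₀) ^ 2 = 0 := by
          have := hR.residue_two (by omega)
          linear_combination (-1) * h + (IsLocalRing.residue R z₀ ^ 2 -
            IsLocalRing.residue R z * IsLocalRing.residue R z₀) * this
        exact sub_eq_zero.1 (pow_eq_zero_iff (two_ne_zero)|>.1 h4)
      · intro h; rw [h]
    rw [card_subtype_of_fibers (fun p : R × R => p.1) _
      (fun x => u ^ (κ₁ + 1) ∣ -(u ^ κ₁ * z₀) + x) _ ((2 ^ m) ^ (e - (f - (κ₁ + κ₁)))),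
      hR.card_dvd_shift (by omega), ← pow_add, ← pow_add, normCodim]
    · congr 1
      omega
    · intro x hx
      obtain ⟨w, hw⟩ := hx
      obtain rfl : x = u ^ κ₁ * (z₀ + u * w) := by linear_combination hw
      have hu : u ∣ c - ε * (z₀ + u * w) ^ 2 := (hz _).2 (by simp)
      rw [← hR.card_dvd_shift (show f - (κ₁ + κ₁) ≤ e by omega) (c - ε * (z₀ + u * w) ^ 2)]
      refine Nat.card_congr
        { toFun := fun p => ⟨p.1.2, (hcond _ _).1 (by
            have h := p.2.1.2.2
            rw [show p.1.1 = u ^ κ₁ * (z₀ + u * w) from p.2.2] at h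
            exact h)⟩
          invFun := fun y => ⟨(u ^ κ₁ * (z₀ + u * w), y.1), ⟨?_, ?_, ?_⟩, rfl⟩
          left_inv := fun p => Subtype.ext (Prod.ext p.2.2.symm rfl)
          right_inv := fun _ => rfl }
      · exact (dvd_pow_self u (by omega)).mul_right _
      · exact (dvd_add_right hu).1 ((dvd_pow_self u (by omega)).trans y.2)
      · exact (hcond _ _).2 y.2
    · rintro ⟨x, y⟩ ⟨h1, hy, h3⟩
      simp only at h1 hy h3 ⊢
      have h4 : u ^ (κ₁ + κ₁) ∣ x ^ 2 := by
        refine (dvd_sub_left ((Dvd.intro _ h2.symm).mul_right (c + y))).1 ?_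
        exact (pow_dvd_pow u (by omega)).trans h3
      obtain ⟨z, rfl⟩ := hR.dvd_of_pow_dvd_sq (by omega) h4 κ₁ (by omega)
      rw [hcond] at h3
      have h5 : u ∣ z - z₀ := (hz z).1
        ((dvd_add_left hy).1 ((dvd_pow_self u (by omega)).trans h3))
      obtain ⟨w, hw⟩ := h5
      exact ⟨w, by linear_combination u ^ κ₁ * hw⟩

/-- On the vectors with a given reduction, the coordinate sum and `pairSum` are jointly
equidistributed, also under linear conditions with independent reductions; translating along two
dual vectors makes them run through all values. This needs that the all-one vector is independent of
the other reductions, since otherwise the coordinate sum is tied to the linear conditions. -/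
theorem card_norm_condition (hR : IsEvenChainRing R u e m κ) (hκ : 2 ≤ κ) (hκe : Even κ) {f : ℕ}
    (hf : 1 ≤ f) (hfe : f ≤ e) {ι : Type*} [Fintype ι] (a : ι → Fin n → R) (t : Fin n → R)
    (ha : LinearIndependent (IsLocalRing.ResidueField R)
      fun i : Option (Option ι) => red (i.elim t fun i => i.elim 1 a))
    (ht : 1 ⬝ᵥ red t = 0) (B : ι → R → Prop) :
    Nat.card {v : Fin n → R // (red v = red t ∧ ∀ j, B j (a j ⬝ᵥ v)) ∧ u ^ f ∣ v ⬝ᵥ v} *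
      (2 ^ m) ^ normCodim κ f =
      Nat.card {v : Fin n → R // red v = red t ∧ ∀ j, B j (a j ⬝ᵥ v)} := by
  classical
  have := hR.finite
  obtain ⟨w, hw⟩ := exists_dual _ ha
  obtain ⟨w₁, hw₁⟩ : ∃ w₁, w₁ = w (some none) := ⟨_, rfl⟩
  obtain ⟨w₂, hw₂⟩ : ∃ w₂, w₂ = w none := ⟨_, rfl⟩
  have ha₁ : ∀ j, a j ⬝ᵥ w₁ = 0 := fun j => by simpa [hw₁] using hw (some (some j)) (some none)
  have ha₂ : ∀ j, a j ⬝ᵥ w₂ = 0 := fun j => by simpa [hw₂] using hw (some (some j)) none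
  have h11 : 1 ⬝ᵥ w₁ = 1 := by simpa [hw₁] using hw (some none) (some none)
  have h12 : 1 ⬝ᵥ w₂ = 0 := by simpa [hw₂] using hw (some none) none
  have ht₂ : t ⬝ᵥ w₂ = 1 := by simpa [hw₂] using hw none none
  let T := {r : R // u ∣ r}
  let g : T × T → Fin n → R := fun r => (r.1 : R) • w₁ + (r.2 : R) • w₂
  have hred : ∀ r, red (g r) = 0 := fun r => by
    simp only [g]
    rw [red_add, red_smul, red_smul, hR.residue_of_dvd r.1.2, hR.residue_of_dvd r.2.2]
    simp
  have hag : ∀ r j, a j ⬝ᵥ g r = 0 := fun r j => by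
    simp only [g]
    rw [dotProduct_add, dotProduct_smul, dotProduct_smul, ha₁, ha₂]
    simp
  have h1g : ∀ r, 1 ⬝ᵥ g r = r.1 := fun r => by
    simp only [g]
    rw [dotProduct_add, dotProduct_smul, dotProduct_smul, h11, h12]
    simp
  have key := card_mul_card_of_translate g (fun v => red v = red t ∧ ∀ j, B j (a j ⬝ᵥ v))
    (fun v => u ^ f ∣ v ⬝ᵥ v)
    (fun v r => by simp only [red_add, hred, dotProduct_add, hag, add_zero])
    (Nat.card {p : R × R // u ∣ p.1 ∧ u ∣ p.2 ∧ u ^ f ∣ p.1 ^ 2 - 2 * (pairSum t + p.2)}) (by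
    rintro v ⟨hv, -⟩
    have hmem : ∀ r, u ∣ 1 ⬝ᵥ (v + g r) ∧ u ∣ pairSum (v + g r) - pairSum t := by
      intro r
      have : red (v + g r) = red t := by rw [red_add, hred, add_zero, hv]
      rw [← hR.residue_eq_zero_iff, ← hR.residue_eq_iff, residue_dotProduct, residue_pairSum,
        residue_pairSum, this, red_one]
      exact ⟨ht, rfl⟩
    let φ : T × T → T × T := fun r => (⟨1 ⬝ᵥ (v + g r), (hmem r).1⟩,
      ⟨pairSum (v + g r) - pairSum t, (hmem r).2⟩)
    have hφ : Function.Injective φ := by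
      rintro ⟨r₁, r₂⟩ ⟨r₁', r₂'⟩ h
      have h1 := congrArg (fun p => (p.1 : R)) h
      have h2 := congrArg (fun p => (p.2 : R)) h
      simp only [φ, dotProduct_add, h1g] at h1 h2
      obtain rfl : r₁ = r₁' := Subtype.ext (by simpa using h1)
      -- along the second direction `pairSum` is injective: its slope is a unit
      obtain ⟨v', hv'_def⟩ : ∃ v', v' = v + (r₁ : R) • w₁ := ⟨_, rfl⟩
      have hv' : ∀ r : T, v + g (r₁, r) = v' + (r : R) • w₂ := fun r => by
        simp only [g, hv'_def, add_assoc]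
      have hunit : IsUnit (v' ⬝ᵥ w₂ - (r₂ + r₂' : R) * pairSum w₂) := by
        apply hR.isUnit_of_not_dvd
        rw [← hR.residue_eq_zero_iff, map_sub, map_mul, map_add, hR.residue_of_dvd r₂.2,
          hR.residue_of_dvd r₂'.2, residue_dotProduct]
        have : red v' = red t := by
          rw [hv'_def, red_add, red_smul, hR.residue_of_dvd r₁.2, zero_smul, add_zero, hv]
        rw [this, ← residue_dotProduct, ht₂]
        simp
      rw [hv', hv', pairSum_add, pairSum_add, pairSum_smul, pairSum_smul, dotProduct_smul,
        dotProduct_smul, dotProduct_smul, dotProduct_smul, h12] at h2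
      simp only [smul_eq_mul, mul_zero, zero_sub] at h2
      have h3 : ((r₂ : R) - r₂') * (v' ⬝ᵥ w₂ - (r₂ + r₂' : R) * pairSum w₂) = 0 := by
        linear_combination -h2
      rw [hunit.mul_left_eq_zero] at h3
      rw [Subtype.ext (sub_eq_zero.1 h3)]
    have hφ' : Function.Bijective φ := Finite.injective_iff_bijective.1 hφ
    have e1 : {r // u ^ f ∣ (v + g r) ⬝ᵥ (v + g r)} ≃
        {p : T × T // u ^ f ∣ (p.1 : R) ^ 2 - 2 * (pairSum t + p.2)} :=
      (Equiv.ofBijective φ hφ').subtypeEquiv fun r => by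
        rw [dotProduct_self_eq]
        simp [φ]
    rw [Nat.card_congr e1]
    exact Nat.card_congr
      { toFun := fun p => ⟨(p.1.1, p.1.2), p.1.1.2, p.1.2.2, p.2⟩
        invFun := fun p => ⟨(⟨p.1.1, p.2.1⟩, ⟨p.1.2, p.2.2.1⟩), p.2.2.2⟩
        left_inv := fun _ => rfl
        right_inv := fun _ => rfl })
  have hW := card_square_pairs hR hκ hκe hf hfe (pairSum t)
  rw [Nat.card_prod, hR.card_maximalIdeal] at key
  apply Nat.eq_of_mul_eq_mul_right
    (show 0 < (2 ^ m) ^ (e - 1) * (2 ^ m) ^ (e - 1) by positivity)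
  calc _ = _ * (2 ^ m) ^ normCodim κ f := by rw [mul_right_comm, key]
    _ = _ := by rw [mul_assoc, hW, ← pow_add, two_mul]

end Counting
/-! ### Block indices -/

section Blocks

theorem partialSum_mono (lam : ℕ → ℕ) : Monotone (partialSum lam) := fun _ _ h =>
  Finset.sum_le_sum_of_subset (Finset.Icc_subset_Icc_right h)

theorem partialSum_zero (lam : ℕ → ℕ) : partialSum lam 0 = 0 := rfl

theorem partialSum_succ (lam : ℕ → ℕ) (i : ℕ) :
    partialSum lam (i + 1) = partialSum lam i + lam (i + 1) :=
  Finset.sum_Icc_succ_top (by omega) _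

theorem blockIndex_lt_iff (lam : ℕ → ℕ) {e i : ℕ} (hi : i ≤ e) (c : ℕ) :
    blockIndex lam e c < i ↔ c < partialSum lam i := by
  have hmono := partialSum_mono lam
  unfold blockIndex
  constructor
  · intro h
    by_contra hc
    rw [not_lt] at hc
    have : Finset.Icc 1 i ⊆ (Finset.Icc 1 e).filter fun i => partialSum lam i ≤ c := by
      intro j hj
      rw [Finset.mem_Icc] at hj
      rw [Finset.mem_filter, Finset.mem_Icc]
      exact ⟨⟨hj.1, hj.2.trans hi⟩, (hmono hj.2).trans hc⟩
    have := Finset.card_le_card this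
    rw [Nat.card_Icc] at this
    omega
  · intro h
    have hi0 : i ≠ 0 := by rintro rfl; simp [partialSum_zero] at h
    have : ((Finset.Icc 1 e).filter fun i => partialSum lam i ≤ c) ⊆ Finset.Icc 1 (i - 1) := by
      intro j hj
      rw [Finset.mem_filter, Finset.mem_Icc] at hj
      rw [Finset.mem_Icc]
      refine ⟨hj.1.1, ?_⟩
      by_contra hji
      have := hmono (show i ≤ j by omega)
      omega
    have := Finset.card_le_card this
    rw [Nat.card_Icc] at this
    omega

theorem blockIndex_le_iff (lam : ℕ → ℕ) {e i : ℕ} (hi : i < e) (c : ℕ) :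
    blockIndex lam e c ≤ i ↔ c < partialSum lam (i + 1) := by
  rw [← Nat.lt_succ_iff]; exact blockIndex_lt_iff lam hi c

theorem blockIndex_mono (lam : ℕ → ℕ) (e : ℕ) : Monotone (blockIndex lam e) := fun _ _ h =>
  Finset.card_le_card fun _ hj => by
    rw [Finset.mem_filter] at hj ⊢
    exact ⟨hj.1, hj.2.trans h⟩

theorem blockIndex_lt (lam : ℕ → ℕ) {e c : ℕ} (h : c < partialSum lam e) : blockIndex lam e c < e :=
  (blockIndex_lt_iff lam le_rfl c).2 h

theorem lt_partialSum_blockIndex (lam : ℕ → ℕ) {e c : ℕ} (h : c < partialSum lam e) :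
    c < partialSum lam (blockIndex lam e c + 1) :=
  (blockIndex_le_iff lam (blockIndex_lt lam h) c).1 le_rfl

end Blocks

/-! ### Adapted bases of flags -/

section LinearAlgebra

variable {K V : Type*} [Field K] [AddCommGroup V] [Module K V]

theorem finrank_span_prefix {N : ℕ} {t : Fin N → V} (ht : LinearIndependent K t) {k : ℕ}
    (hk : k ≤ N) : Module.finrank K (Submodule.span K (t '' {r | (r : ℕ) < k})) = k := by
  have h1 : t '' {r | (r : ℕ) < k} = Set.range (t ∘ Fin.castLE hk) := by
    ext x
    constructor
    · rintro ⟨r, hr, rfl⟩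
      exact ⟨⟨r, hr⟩, rfl⟩
    · rintro ⟨r, rfl⟩
      exact ⟨Fin.castLE hk r, r.2, rfl⟩
  rw [h1, finrank_span_eq_card (ht.comp _ (Fin.castLE_injective hk)), Fintype.card_fin]

/-- Vectors whose coordinates at pivot positions form an invertible triangular array. -/
theorem linearIndependent_of_triangular {N n : ℕ} (t : Fin N → Fin n → K) (p : Fin N → Fin n)
    (hdiag : ∀ i, t i (p i) ≠ 0) (htri : ∀ i j, j < i → t i (p j) = 0) :
    LinearIndependent K t := by
  rw [Fintype.linearIndependent_iff]
  intro g hg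
  by_contra! hne
  obtain ⟨i, hi⟩ := hne
  -- evaluate at the pivot of the first nonzero coefficient
  obtain ⟨j, hj, hmin⟩ := WellFounded.has_min (wellFounded_lt (α := Fin N)) {i | g i ≠ 0} ⟨i, hi⟩
  have := congrFun hg (p j)
  rw [Finset.sum_apply, Finset.sum_eq_single j] at this
  · exact (mul_ne_zero hj (hdiag j)) this
  · intro b _ hb
    rcases lt_or_gt_of_ne hb with h | h
    · have : g b = 0 := by
        by_contra hb'
        exact hmin b hb' h
      simp [this]
    · simp [htri b j h]
  · simp

/-- A flag has a triangular adapted basis: greedily pick a nonzero vector vanishing at the pivots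
found so far, and a nonzero coordinate of it. -/
theorem exists_triangular_basis {n : ℕ} (N : ℕ) (T : ℕ → Submodule K (Fin n → K))
    (hT : ∀ r < N, r < Module.finrank K (T r)) :
    ∃ (t : Fin N → Fin n → K) (p : Fin N → Fin n), (∀ i : Fin N, t i ∈ T i) ∧ (∀ i, t i (p i) ≠ 0) ∧
      ∀ i j, j < i → t i (p j) = 0 := by
  induction N with
  | zero => exact ⟨Fin.elim0, Fin.elim0, fun i => i.elim0, fun i => i.elim0, fun i => i.elim0⟩
  | succ N ih =>
    obtain ⟨t, p, h1, h2, h3⟩ := ih fun r hr => hT r (hr.trans N.lt_succ_self)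
    let φ : T N →ₗ[K] (Fin N → K) := (LinearMap.funLeft K K p).comp (T N).subtype
    have hker : LinearMap.ker φ ≠ ⊥ := by
      apply LinearMap.ker_ne_bot_of_finrank_lt
      rw [Module.finrank_fin_fun]
      exact hT N N.lt_succ_self
    obtain ⟨x, hx, hx0⟩ := Submodule.exists_mem_ne_zero_of_ne_bot hker
    obtain ⟨c, hc⟩ : ∃ c, x.1 c ≠ 0 := by
      by_contra! h
      exact hx0 (Subtype.ext (funext h))
    refine ⟨Fin.snoc t x.1, Fin.snoc p c, ?_, ?_, ?_⟩
    · intro i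
      refine Fin.lastCases ?_ (fun i => ?_) i
      · rw [Fin.snoc_last]; exact x.2
      · rw [Fin.snoc_castSucc]; exact h1 i
    · intro i
      refine Fin.lastCases ?_ (fun i => ?_) i
      · rw [Fin.snoc_last, Fin.snoc_last]; exact hc
      · rw [Fin.snoc_castSucc, Fin.snoc_castSucc]; exact h2 i
    · intro i j hij
      induction j using Fin.lastCases with
      | last => exact absurd hij (not_lt.2 (Fin.le_last i))
      | cast j =>
        induction i using Fin.lastCases with
        | last =>
          rw [Fin.snoc_last, Fin.snoc_castSucc]
          exact congrFun (LinearMap.mem_ker.1 hx) j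
        | cast i =>
          rw [Fin.snoc_castSucc, Fin.snoc_castSucc]
          exact h3 i j hij

end LinearAlgebra

/-! ### Torsion codes -/

section Torsion

variable {R : Type*} [CommRing R] [IsLocalRing R] {u : R} {e m κ : ℕ} {n : ℕ}

/-- The `j`-th torsion code of `C`, counted from `0`: the reductions of the vectors `v` with
`u ^ j • v ∈ C`. -/
def torsionCode (u : R) (j : ℕ) (C : Submodule R (Fin n → R)) :
    Submodule (IsLocalRing.ResidueField R) (Fin n → IsLocalRing.ResidueField R) where
  carrier := {x | ∃ v, u ^ j • v ∈ C ∧ red v = x}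
  add_mem' := by
    rintro _ _ ⟨v, hv, rfl⟩ ⟨w, hw, rfl⟩
    exact ⟨v + w, by rw [smul_add]; exact C.add_mem hv hw, red_add v w⟩
  zero_mem' := ⟨0, by simp, red_zero⟩
  smul_mem' := by
    rintro c _ ⟨v, hv, rfl⟩
    obtain ⟨r, rfl⟩ := IsLocalRing.residue_surjective c
    exact ⟨r • v, by rw [smul_comm]; exact C.smul_mem r hv, red_smul r v⟩

theorem pow_smul_mem_of_le {R : Type*} [CommRing R] {u : R} {n : ℕ} {C : Submodule R (Fin n → R)} {i j : ℕ} (hij : i ≤ j) {v : Fin n → R}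
    (hv : u ^ i • v ∈ C) : u ^ j • v ∈ C := by
  rw [← Nat.sub_add_cancel hij, pow_add, mul_smul]
  exact C.smul_mem _ hv

theorem torsionCode_mono (C : Submodule R (Fin n → R)) {i j : ℕ} (hij : i ≤ j) :
    torsionCode u i C ≤ torsionCode u j C := by
  rintro _ ⟨v, hv, rfl⟩
  exact ⟨v, pow_smul_mem_of_le hij hv, rfl⟩

theorem torsionCode_le {C C' : Submodule R (Fin n → R)} (h : C ≤ C') (j : ℕ) :
    torsionCode u j C ≤ torsionCode u j C' := by
  rintro _ ⟨v, hv, rfl⟩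
  exact ⟨v, h hv, rfl⟩

theorem IsEvenChainRing.exists_smul_of_red_eq_zero (hR : IsEvenChainRing R u e m κ)
    {v : Fin n → R} (hv : red v = 0) : ∃ w, v = u • w := by
  choose w hw using fun i => hR.residue_eq_zero_iff.1 (congrFun hv i)
  exact ⟨w, funext hw⟩

theorem IsEvenChainRing.red_smul_self (hR : IsEvenChainRing R u e m κ) (w : Fin n → R) :
    red (u • w) = 0 := by
  rw [red_smul, hR.residue_of_dvd dvd_rfl, zero_smul]

theorem IsEvenChainRing.red_eq_zero_of_pow_smul (hR : IsEvenChainRing R u e m κ) {j : ℕ}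
    (hj : j < e) {v : Fin n → R} (hv : u ^ j • v = 0) : red v = 0 := by
  funext i
  have h1 : u ^ j * v i = 0 := congrFun hv i
  rw [hR.pow_mul_eq_zero_iff hj.le] at h1
  exact hR.residue_of_dvd ((dvd_pow_self u (by omega)).trans h1)

/-- A code is determined inside a larger one by its torsion codes; successive approximation modulo
powers of `u`. -/
theorem eq_of_le_of_torsionCode_le (hR : IsEvenChainRing R u e m κ)
    {C C' : Submodule R (Fin n → R)} (h : C ≤ C')
    (ht : ∀ j < e, torsionCode u j C' ≤ torsionCode u j C) : C = C' := by
  refine le_antisymm h ?_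
  have key : ∀ j ≤ e, ∀ w, u ^ j • w ∈ C' → u ^ j • w ∈ C := by
    intro j hj
    induction hj using Nat.decreasingInduction with
    | self => intro w _; rw [hR.pow_eq_zero, zero_smul]; exact C.zero_mem
    | of_succ j hj ih =>
      intro w hw
      obtain ⟨w', hw', hred⟩ := ht j hj ⟨w, hw, rfl⟩
      obtain ⟨z, hz⟩ := hR.exists_smul_of_red_eq_zero (v := w - w') (by
        rw [red_sub, hred, sub_self])
      have h1 : u ^ (j + 1) • z = u ^ j • w - u ^ j • w' := by
        rw [pow_succ, mul_smul, ← hz, smul_sub]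
      have h2 := ih z (by rw [h1]; exact C'.sub_mem hw (h hw'))
      rw [h1] at h2
      simpa using C.add_mem h2 hw'
  intro w hw
  simpa using key 0 (Nat.zero_le _) w (by simpa using hw)

/-- Vectors with independent reductions span a submodule that is pure for divisibility by powers of
`u`. -/
theorem dvd_of_sum_smul_eq (hR : IsEvenChainRing R u e m κ) {ι : Type*} [Fintype ι]
    {v : ι → Fin n → R} (hv : LinearIndependent (IsLocalRing.ResidueField R) fun i => red (v i))
    {j : ℕ} (hj : j ≤ e) (c : ι → R) (w : Fin n → R) (h : ∑ i, c i • v i = u ^ j • w) (i : ι) :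
    u ^ j ∣ c i := by
  induction j generalizing w i with
  | zero => simp
  | succ j ih =>
    have h1 := fun i => ih (by omega) (u • w) (by rw [h, pow_succ, mul_smul]) i
    choose d hd using h1
    have h2 : u ^ j • (∑ i, d i • v i - u • w) = 0 := by
      rw [smul_sub, Finset.smul_sum, ← mul_smul, ← pow_succ, ← h, sub_eq_zero]
      exact Finset.sum_congr rfl fun i _ => by rw [← mul_smul, ← hd]
    have h3 := hR.red_eq_zero_of_pow_smul (by omega) h2
    rw [red_sub, hR.red_smul_self, sub_zero, red_sum] at h3
    simp only [red_smul] at h3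
    have h4 := Fintype.linearIndependent_iff.1 hv _ h3 i
    rw [hd, pow_succ]
    exact mul_dvd_mul_left _ (hR.residue_eq_zero_iff.1 h4)

/-- The code generated by the vectors `u ^ β r • v r`. -/
def generatedCode (u : R) {ι : Type*} (β : ι → ℕ) (v : ι → Fin n → R) : Submodule R (Fin n → R) :=
  Submodule.span R (Set.range fun r => u ^ β r • v r)

/-- The torsion codes of a generated code are spanned by the reductions of the generators of bounded
level. -/
theorem torsionCode_generatedCode (hR : IsEvenChainRing R u e m κ) {ι : Type*} [Fintype ι]
    (β : ι → ℕ) {v : ι → Fin n → R}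
    (hv : LinearIndependent (IsLocalRing.ResidueField R) fun i => red (v i)) {j : ℕ} (hj : j < e) :
    torsionCode u j (generatedCode u β v) =
      Submodule.span _ ((fun i => red (v i)) '' {i | β i ≤ j}) := by
  apply le_antisymm
  · rintro _ ⟨w, hw, rfl⟩
    obtain ⟨a, ha⟩ := (Submodule.mem_span_range_iff_exists_fun R).1 hw
    have h1 := dvd_of_sum_smul_eq hR hv hj.le (fun i => a i * u ^ β i) w (by
      rw [← ha]; exact Finset.sum_congr rfl fun i _ => by rw [mul_smul])
    have h2 : ∀ i, ∃ d, a i * u ^ β i = u ^ j * d ∧ (j < β i → u ∣ d) := by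
      intro i
      by_cases hi : j < β i
      · exact ⟨a i * u ^ (β i - j), by
          rw [show β i = j + (β i - j) by omega, pow_add]
          rw [show j + (β i - j) - j = β i - j by omega]; ring,
          fun _ => (dvd_pow_self u (by omega)).mul_left _⟩
      · obtain ⟨d, hd⟩ := h1 i
        exact ⟨d, hd, fun h => absurd h hi⟩
    choose d hd hd' using h2
    have h3 : u ^ j • (w - ∑ i, d i • v i) = 0 := by
      rw [smul_sub, ← ha, Finset.smul_sum, sub_eq_zero]
      exact Finset.sum_congr rfl fun i _ => by rw [← mul_smul, ← mul_smul, hd]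
    have h4 := hR.red_eq_zero_of_pow_smul hj h3
    rw [red_sub, sub_eq_zero, red_sum] at h4
    rw [h4]
    refine Submodule.sum_mem _ fun i _ => ?_
    rw [red_smul]
    by_cases hi : β i ≤ j
    · exact Submodule.smul_mem _ _ (Submodule.subset_span ⟨i, hi, rfl⟩)
    · rw [hR.residue_of_dvd (hd' i (not_le.1 hi)), zero_smul]
      exact Submodule.zero_mem _
  · rw [Submodule.span_le]
    rintro _ ⟨i, hi, rfl⟩
    exact ⟨v i, pow_smul_mem_of_le hi (Submodule.subset_span ⟨i, rfl⟩), rfl⟩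

/-- The torsion codes of `C` have the dimensions prescribed by `lam`. -/
def HasTorsionDims (u : R) (e : ℕ) (lam : ℕ → ℕ) (C : Submodule R (Fin n → R)) : Prop :=
  ∀ j < e, Module.finrank (IsLocalRing.ResidueField R) (torsionCode u j C) = partialSum lam (j + 1)

theorem hasTorsionDims_generatedCode (hR : IsEvenChainRing R u e m κ) (lam : ℕ → ℕ)
    {v : Fin (partialSum lam e) → Fin n → R}
    (hv : LinearIndependent (IsLocalRing.ResidueField R) fun i => red (v i)) :
    HasTorsionDims u e lam (generatedCode u (fun r : Fin _ => blockIndex lam e r) v) := by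
  intro j hj
  rw [torsionCode_generatedCode hR _ hv hj]
  have h : {i : Fin (partialSum lam e) | blockIndex lam e i ≤ j} =
      {r : Fin (partialSum lam e) | (r : ℕ) < partialSum lam (j + 1)} := Set.ext fun r => blockIndex_le_iff lam hj r
  change Module.finrank _ (Submodule.span _ (_ '' {i : Fin (partialSum lam e) | _})) = _
  rw [h]
  exact finrank_span_prefix hv (partialSum_mono lam hj)

theorem generatedCode_eq (hR : IsEvenChainRing R u e m κ) (lam : ℕ → ℕ)
    {v : Fin (partialSum lam e) → Fin n → R}
    (hv : LinearIndependent (IsLocalRing.ResidueField R) fun i => red (v i))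
    {C : Submodule R (Fin n → R)} (hC : HasTorsionDims u e lam C)
    (hvC : ∀ r : Fin _, u ^ blockIndex lam e r • v r ∈ C) :
    generatedCode u (fun r : Fin _ => blockIndex lam e r) v = C := by
  have hle : generatedCode u (fun r : Fin _ => blockIndex lam e r) v ≤ C := by
    rw [generatedCode, Submodule.span_le]
    rintro _ ⟨r, rfl⟩
    exact hvC r
  refine eq_of_le_of_torsionCode_le hR hle fun j hj => ?_
  refine (Submodule.eq_of_le_of_finrank_eq (torsionCode_le hle j) ?_).ge
  rw [hC j hj, hasTorsionDims_generatedCode hR lam hv j hj]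

theorem torsionCode_map_funLeft (σ : Equiv.Perm (Fin n)) (j : ℕ) (C : Submodule R (Fin n → R)) :
    torsionCode u j (C.map (LinearMap.funLeft R R σ)) =
      (torsionCode u j C).map (LinearMap.funLeft _ _ σ) := by
  ext x
  constructor
  · rintro ⟨v, ⟨w, hw, hwv⟩, rfl⟩
    have h1 : w = u ^ j • (v ∘ σ.symm) := by
      funext i
      have := congrFun hwv (σ.symm i)
      simpa [LinearMap.funLeft_apply] using this
    refine ⟨red (v ∘ σ.symm), ⟨v ∘ σ.symm, h1 ▸ hw, rfl⟩, ?_⟩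
    funext i
    simp [LinearMap.funLeft_apply, red_apply]
  · rintro ⟨_, ⟨v, hv, rfl⟩, rfl⟩
    exact ⟨v ∘ σ, ⟨_, hv, rfl⟩, rfl⟩

theorem hasTorsionDims_map_funLeft (σ : Equiv.Perm (Fin n)) {lam : ℕ → ℕ}
    {C : Submodule R (Fin n → R)} :
    HasTorsionDims u e lam (C.map (LinearMap.funLeft R R σ)) ↔ HasTorsionDims u e lam C := by
  refine forall₂_congr fun j _ => ?_
  rw [torsionCode_map_funLeft, ← (Submodule.equivMapOfInjective _
    (LinearMap.funLeft_injective_of_surjective _ _ _ σ.surjective) _).finrank_eq]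

end Torsion
/-! ### The type of a code and its torsion codes -/

section Types

variable {R : Type*} [CommRing R] [IsLocalRing R] {u : R} {e m κ : ℕ} {n : ℕ}

theorem linearIndependent_red_of_standardForm (lam : ℕ → ℕ) (hN : partialSum lam e ≤ n)
    {A : Matrix (Fin (partialSum lam e)) (Fin n) R}
    (h0 : ∀ (r : Fin (partialSum lam e)) (c : Fin n), blockIndex lam e c < blockIndex lam e r →
      A r c = 0)
    (h1 : ∀ (r : Fin (partialSum lam e)) (c : Fin n), blockIndex lam e c = blockIndex lam e r →
      A r c = if (c : ℕ) = (r : ℕ) then 1 else 0) :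
    LinearIndependent (IsLocalRing.ResidueField R) fun r => red (A r) := by
  apply linearIndependent_of_triangular _ (Fin.castLE hN)
  · intro i
    rw [red_apply, h1 i _ rfl]
    simp
  · intro i j hij
    rw [red_apply]
    rcases (blockIndex_mono lam e (show (j : ℕ) ≤ i from hij.le)).lt_or_eq with h | h
    · rw [h0 i _ h, map_zero]
    · rw [h1 i _ h]
      simp [Fin.val_ne_of_ne hij.ne]

/-- Vectors generating `C` that take the values of the unit vectors at suitable pivot positions: at
every level, the pivots of the rows of that level or below form an information set. -/
theorem exists_pivot_generators (lam : ℕ → ℕ)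
    {C : Submodule R (Fin n → R)} (hC : HasTorsionDims u e lam C) :
    ∃ (v : Fin (partialSum lam e) → Fin n → R) (p : Fin (partialSum lam e) → Fin n),
      Function.Injective p ∧ (∀ r : Fin (partialSum lam e), u ^ blockIndex lam e r • v r ∈ C) ∧
      ∀ r c : Fin (partialSum lam e), blockIndex lam e c ≤ blockIndex lam e r →
        v r (p c) = if c = r then 1 else 0 := by
  obtain ⟨t, p, ht, hdiag, htri⟩ := exists_triangular_basis (partialSum lam e)
    (fun r => torsionCode u (blockIndex lam e r) C) (fun r hr => by
      rw [hC _ (blockIndex_lt lam hr)]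
      exact lt_partialSum_blockIndex lam hr)
  choose s hsC hs using ht
  have hv : ∀ r : Fin (partialSum lam e), ∃ v : Fin n → R, u ^ blockIndex lam e r • v ∈ C ∧
      ∀ c : Fin (partialSum lam e), blockIndex lam e c ≤ blockIndex lam e r →
        v (p c) = if c = r then 1 else 0 := by
    intro r
    let I := {c : Fin (partialSum lam e) // blockIndex lam e c ≤ blockIndex lam e r}
    let S : Matrix I I R := Matrix.of fun i j => s i.1 (p j.1)
    have hdet : IsUnit S.det := by
      rw [← isUnit_map_iff (IsLocalRing.residue R), RingHom.map_det,
        Matrix.det_of_isUpperTriangular]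
      · rw [isUnit_iff_ne_zero, Finset.prod_ne_zero_iff]
        intro i _
        have := hdiag i.1
        rwa [← hs] at this
      · intro i j hij
        have := htri i.1 j.1
        rw [← hs] at this
        exact this (lt_of_lt_of_eq hij rfl)
    refine ⟨∑ i : I, S⁻¹ ⟨r, le_rfl⟩ i • s i.1, ?_, fun c hc => ?_⟩
    · rw [Finset.smul_sum]
      refine Submodule.sum_mem _ fun i _ => ?_
      rw [smul_comm]
      exact C.smul_mem _ (pow_smul_mem_of_le i.2 (hsC i.1))
    · have := congrFun (congrFun (Matrix.nonsing_inv_mul S hdet) ⟨r, le_rfl⟩) ⟨c, hc⟩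
      rw [Matrix.mul_apply, Matrix.one_apply] at this
      rw [Finset.sum_apply]
      simp only [Pi.smul_apply, smul_eq_mul]
      refine this.trans ?_
      simp only [Subtype.mk.injEq, eq_comm]
  choose v hvC hv using hv
  refine ⟨v, p, fun i j hij => ?_, hvC, hv⟩
  by_contra hne
  rcases lt_or_gt_of_ne hne with h | h
  · exact hdiag j (hij ▸ htri j i h)
  · exact hdiag i (hij ▸ htri i j h)

theorem exists_perm_extending {N n : ℕ} (hN : N ≤ n) (p : Fin N → Fin n)
    (hp : Function.Injective p) : ∃ σ : Equiv.Perm (Fin n), ∀ i, σ (Fin.castLE hN i) = p i := by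
  classical
  let f : {x // x ∈ Set.range (Fin.castLE hN)} ≃ {x // x ∈ Set.range p} :=
    (Equiv.ofInjective _ (Fin.castLE_injective hN)).symm.trans (Equiv.ofInjective p hp)
  refine ⟨f.extendSubtype, fun i => ?_⟩
  rw [Equiv.extendSubtype_apply_of_mem f _ ⟨i, rfl⟩]
  have : (Equiv.ofInjective _ (Fin.castLE_injective hN)).symm ⟨Fin.castLE hN i, ⟨i, rfl⟩⟩ = i :=
    Equiv.ofInjective_symm_apply (Fin.castLE_injective hN) i
  simp [f, this]

/-- The type of a code is the sequence of dimension jumps of its torsion codes. -/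
theorem isOfType_iff (hR : IsEvenChainRing R u e m κ) (lam : ℕ → ℕ) (hN : partialSum lam e ≤ n)
    (C : Submodule R (Fin n → R)) : IsOfType u e lam C ↔ HasTorsionDims u e lam C := by
  constructor
  · rintro ⟨C', ⟨σ, hσ⟩, G, ⟨A, h0, h1, hG⟩, hC'⟩
    rw [← hasTorsionDims_map_funLeft σ, ← hσ]
    have h2 : C' = generatedCode u (fun r : Fin _ => blockIndex lam e r) A := by
      rw [hC']
      exact congrArg (fun f => Submodule.span R (Set.range f))
        (funext fun r => funext fun c => hG r c)
    rw [h2]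
    exact hasTorsionDims_generatedCode hR lam (linearIndependent_red_of_standardForm lam hN h0 h1)
  · intro hC
    obtain ⟨v, p, hp, hvC, hvp⟩ := exists_pivot_generators lam hC
    obtain ⟨σ, hσ⟩ := exists_perm_extending hN p hp
    let A : Matrix (Fin (partialSum lam e)) (Fin n) R := fun r => v r ∘ σ
    have hA : ∀ (r : Fin (partialSum lam e)) (c : Fin n), blockIndex lam e c ≤ blockIndex lam e r →
        A r c = if (c : ℕ) = (r : ℕ) then 1 else 0 := by
      intro r c hc
      have hcN : (c : ℕ) < partialSum lam e :=
        (blockIndex_lt_iff lam le_rfl c).1 (hc.trans_lt (blockIndex_lt lam r.2))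
      have h1 : σ c = p ⟨c, hcN⟩ := hσ ⟨c, hcN⟩
      have h2 := hvp r ⟨c, hcN⟩ hc
      simp only [A, Function.comp_apply]
      rw [h1, h2]
      simp only [Fin.ext_iff]
    have hA0 : ∀ (r : Fin (partialSum lam e)) (c : Fin n),
        blockIndex lam e c < blockIndex lam e r → A r c = 0 := by
      intro r c hc
      rw [hA r c hc.le, if_neg]
      intro h
      rw [h] at hc
      exact lt_irrefl _ hc
    refine ⟨C.map (LinearMap.funLeft R R σ), ⟨σ, rfl⟩,
      Matrix.of fun r c => u ^ blockIndex lam e r * A r c,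
      ⟨A, hA0, fun r c hc => hA r c hc.le, fun _ _ => rfl⟩, ?_⟩
    exact (generatedCode_eq hR lam
      (linearIndependent_red_of_standardForm lam hN hA0 fun r c hc => hA r c hc.le)
      ((hasTorsionDims_map_funLeft σ).2 hC) fun r => ⟨_, hvC r, rfl⟩).symm

/-- The exponent of `2 ^ m` in the number of vectors `v` with zero reduction and `u ^ j • v ∈ C`, for a
code `C` of type `lam`. -/
def colonExponent (lam : ℕ → ℕ) (e n j : ℕ) : ℕ :=
  ∑ p ∈ Finset.Icc (j + 2) e, partialSum lam p + n * j

/-- Multiplication by `u` and reduction, both on `{v | u ^ (j + 1) • v ∈ C}`, relate the counts for `j`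
and `j + 1`. -/
theorem card_colon (hR : IsEvenChainRing R u e m κ) (lam : ℕ → ℕ)
    {C : Submodule R (Fin n → R)} (hC : HasTorsionDims u e lam C) {j : ℕ} (hj : j < e) :
    Nat.card {v : Fin n → R // red v = 0 ∧ u ^ j • v ∈ C} =
      (2 ^ m) ^ colonExponent lam e n j := by
  have := hR.finite
  have := hR.finite_residueField
  have hj' : j ≤ e - 1 := by omega
  clear hj
  induction hj' using Nat.decreasingInduction with
  | self =>
    have h1 := hR.card_red_eq (0 : Fin n → R)
    rw [red_zero, ← pow_mul] at h1
    have he := hR.e_pos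
    rw [colonExponent, Finset.Icc_eq_empty (by omega), Finset.sum_empty, zero_add, mul_comm, ← h1]
    refine Nat.card_congr (Equiv.subtypeEquivRight fun v => ⟨fun h => h.1, fun h => ⟨h, ?_⟩⟩)
    obtain ⟨w, rfl⟩ := hR.exists_smul_of_red_eq_zero h
    rw [← mul_smul, ← pow_succ, Nat.sub_add_cancel he, hR.pow_eq_zero, zero_smul]
    exact C.zero_mem
  | of_succ j hj ih =>
    let A : AddSubgroup (Fin n → R) :=
      (C.comap (LinearMap.lsmul R (Fin n → R) (u ^ (j + 1)))).toAddSubgroup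
    have hA : ∀ v, v ∈ A ↔ u ^ (j + 1) • v ∈ C := fun v => Iff.rfl
    have h1 := card_addSubgroup_eq_map_mul_ker A (DistribSMul.toAddMonoidHom (Fin n → R) u)
    let ρ : (Fin n → R) →+ (Fin n → IsLocalRing.ResidueField R) :=
      { toFun := red, map_zero' := red_zero, map_add' := red_add }
    have h2 := card_addSubgroup_eq_map_mul_ker A ρ
    have h3 : Nat.card (A.map (DistribSMul.toAddMonoidHom (Fin n → R) u)) =
        Nat.card {v : Fin n → R // red v = 0 ∧ u ^ j • v ∈ C} := by
      refine Nat.card_congr (Equiv.subtypeEquivRight fun v => ?_)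
      constructor
      · rintro ⟨w, hw, rfl⟩
        refine ⟨hR.red_smul_self w, ?_⟩
        have := (hA w).1 hw
        rw [pow_succ, mul_smul] at this
        exact this
      · rintro ⟨h, h'⟩
        obtain ⟨w, rfl⟩ := hR.exists_smul_of_red_eq_zero h
        refine ⟨w, ?_, rfl⟩
        change u ^ (j + 1) • w ∈ C
        rwa [pow_succ, mul_smul]
    have h4 : Nat.card (A ⊓ (DistribSMul.toAddMonoidHom (Fin n → R) u).ker :
        AddSubgroup (Fin n → R)) = (2 ^ m) ^ n := by
      have h5 := hR.card_pow_dvd (show e - 1 ≤ e by omega)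
      rw [show e - (e - 1) = 1 by have := hR.e_pos; omega, pow_one] at h5
      rw [← h5]
      have h6 : Nat.card (Fin n → {y : R // u ^ (e - 1) ∣ y}) =
          Nat.card {y : R // u ^ (e - 1) ∣ y} ^ n := by
        rw [Nat.card_pi]; simp
      rw [← h6]
      have h7 : ∀ y : R, u * y = 0 ↔ u ^ (e - 1) ∣ y := fun y => by
        have := hR.pow_mul_eq_zero_iff (j := 1) hR.e_pos (y := y)
        rwa [pow_one] at this
      refine Nat.card_congr ((Equiv.subtypeEquivRight fun v => ?_).trans
        (Equiv.subtypePiEquivPi (p := fun (_ : Fin n) (y : R) => u ^ (e - 1) ∣ y)))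
      rw [AddSubgroup.mem_inf, AddMonoidHom.mem_ker, hA]
      have h8 : (DistribSMul.toAddMonoidHom (Fin n → R) u) v = u • v := rfl
      rw [h8]
      constructor
      · exact fun h i => (h7 _).1 (congrFun h.2 i)
      · intro h
        have h9 : u • v = 0 := funext fun i => (h7 _).2 (h i)
        refine ⟨?_, h9⟩
        rw [pow_succ, mul_smul, h9, smul_zero]
        exact C.zero_mem
    have h5 : Nat.card (A.map ρ) = (2 ^ m) ^ partialSum lam (j + 2) := by
      rw [← hC (j + 1) (by omega), ← hR.card_residueField, ← Module.natCard_eq_pow_finrank]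
      exact Nat.card_congr (Equiv.subtypeEquivRight fun v => Iff.rfl)
    have h6 : Nat.card (A ⊓ ρ.ker : AddSubgroup (Fin n → R)) =
        Nat.card {v : Fin n → R // red v = 0 ∧ u ^ (j + 1) • v ∈ C} :=
      Nat.card_congr (Equiv.subtypeEquivRight fun v => and_comm)
    rw [h3, h4, h2, h5, h6, ih] at h1
    apply Nat.eq_of_mul_eq_mul_right (show 0 < (2 ^ m) ^ n by positivity)
    rw [← h1, ← pow_add, ← pow_add]
    congr 1
    rw [colonExponent, colonExponent, ← Finset.add_sum_Ioc_eq_sum_Icc (a := j + 2) (by omega)]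
    have : Finset.Ioc (j + 2) e = Finset.Icc (j + 1 + 2) e := by
      ext; simp; omega
    rw [this]
    ring

end Types
/-! ### Rational counting -/

section Fibers

/-- Counting by fibres of constant size, with the size given as a rational number. -/
theorem cast_card_subtype_of_fibers {α β : Type*} [Finite α] [Finite β] (f : α → β) (P : α → Prop)
    (T : β → Prop) (hPT : ∀ a, P a → T (f a)) (c : ℚ)
    (h : ∀ b, T b → (Nat.card {a // P a ∧ f a = b} : ℚ) = c) :
    (Nat.card {a // P a} : ℚ) = Nat.card {b // T b} * c := by
  by_cases hT : ∃ b, T b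
  · obtain ⟨b₀, hb₀⟩ := hT
    rw [card_subtype_of_fibers f P T hPT (Nat.card {a // P a ∧ f a = b₀})]
    · rw [Nat.cast_mul, h b₀ hb₀]
    · intro b hb
      have := (h b hb).trans (h b₀ hb₀).symm
      exact_mod_cast this
  · have h1 : IsEmpty {a // P a} := ⟨fun a => hT ⟨_, hPT a a.2⟩⟩
    have h2 : IsEmpty {b // T b} := ⟨fun b => hT ⟨_, b.2⟩⟩
    simp

theorem finite_submodule {A M : Type*} [Semiring A] [AddCommMonoid M] [Module A M] [Finite M] :
    Finite (Submodule A M) :=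
  Finite.of_injective (fun S : Submodule A M => (S : Set M)) SetLike.coe_injective

theorem cast_eq_zpow {q c A B : ℕ} (hq : 0 < q) (h : c * q ^ A = q ^ B) :
    (c : ℚ) = (q : ℚ) ^ ((B : ℤ) - A) := by
  have hq' : (q : ℚ) ≠ 0 := by positivity
  rw [zpow_sub₀ hq', zpow_natCast, zpow_natCast, eq_div_iff (by positivity)]
  exact_mod_cast h

end Fibers

/-! ### Self-orthogonal spans -/

section SelfOrthogonal

variable {A : Type*} [CommRing A] {n : ℕ}

theorem IsSelfOrthogonal.dotProduct_eq_zero {C : Submodule A (Fin n → A)}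
    (hC : IsSelfOrthogonal C) {v w : Fin n → A} (hv : v ∈ C) (hw : w ∈ C) : v ⬝ᵥ w = 0 :=
  hC hw v hv

theorem isSelfOrthogonal_span {s : Set (Fin n → A)} (hs : ∀ x ∈ s, ∀ y ∈ s, x ⬝ᵥ y = 0) :
    IsSelfOrthogonal (Submodule.span A s) := by
  have h1 : ∀ x ∈ s, ∀ y ∈ Submodule.span A s, y ⬝ᵥ x = 0 := by
    intro x hx y hy
    induction hy using Submodule.span_induction with
    | mem y hy => exact hs y hy x hx
    | zero => exact zero_dotProduct x
    | add y z _ _ h h' => rw [add_dotProduct, h, h', add_zero]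
    | smul c y _ h => rw [smul_dotProduct, h, smul_zero]
  exact Submodule.span_le.2 fun x hx y hy => h1 x hx y hy

end SelfOrthogonal

/-! ### Isotropic sequences and chains over the residue field -/

section FieldCounts

variable {K : Type*} [Field K] {n : ℕ}

theorem cast_card_mem_not_mem [Finite K] {V : Type*} [AddCommGroup V] [Module K V] [Finite V]
    {X Y : Submodule K V} (h : Y ≤ X) :
    (Nat.card {t // t ∉ Y ∧ t ∈ X} : ℚ) =
      (Nat.card K : ℚ) ^ Module.finrank K X - (Nat.card K : ℚ) ^ Module.finrank K Y := by
  have h1 : Nat.card {t // t ∉ Y ∧ t ∈ X} + Nat.card Y = Nat.card X := by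
    have h2 := Set.ncard_sdiff_add_ncard_of_subset (s := (Y : Set V)) (t := (X : Set V)) h
    have h3 : {t | t ∉ Y ∧ t ∈ X} = (X : Set V) \ Y := by
      ext t; exact and_comm
    rw [← h3] at h2
    exact h2
  rw [Module.natCard_eq_pow_finrank (K := K) (V := Y),
    Module.natCard_eq_pow_finrank (K := K) (V := X)] at h1
  rw [eq_sub_iff_add_eq]
  exact_mod_cast h1

/-- The space of vectors orthogonal to a family. -/
def perp {ι : Type*} (a : ι → Fin n → K) : Submodule K (Fin n → K) :=
  LinearMap.ker (Matrix.of a).mulVecLin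

theorem mem_perp {ι : Type*} {a : ι → Fin n → K} {x : Fin n → K} :
    x ∈ perp a ↔ ∀ i, a i ⬝ᵥ x = 0 := by
  rw [perp, LinearMap.mem_ker, funext_iff]
  rfl

theorem finrank_perp {ι : Type*} [Fintype ι] {a : ι → Fin n → K} (ha : LinearIndependent K a) :
    Module.finrank K (perp a) = n - Fintype.card ι := by
  have h1 := LinearMap.finrank_range_add_finrank_ker (Matrix.of a).mulVecLin
  have h2 : (Matrix.of a).rank = Fintype.card ι := LinearIndependent.rank_matrix ha
  rw [Matrix.rank] at h2
  rw [h2, Module.finrank_fin_fun] at h1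
  rw [perp]
  omega

/-- In characteristic two `x ⬝ᵥ x` is the square of the coordinate sum. -/
theorem one_dotProduct_eq_zero_iff (h2 : (2 : K) = 0) (x : Fin n → K) :
    1 ⬝ᵥ x = 0 ↔ x ⬝ᵥ x = 0 := by
  rw [dotProduct_self_eq, h2, zero_mul, sub_zero, pow_eq_zero_iff two_ne_zero]

theorem one_dotProduct_one (h2 : (2 : K) = 0) (hn : Odd n) :
    (1 : Fin n → K) ⬝ᵥ (1 : Fin n → K) = 1 := by
  obtain ⟨k, rfl⟩ := hn
  simp [h2]

/-- In odd length over a field of characteristic two the all-one vector is not isotropic, while it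
is orthogonal to all isotropic vectors. -/
theorem one_not_mem_of_isSelfOrthogonal (h2 : (2 : K) = 0) (hn : Odd n)
    {D : Submodule K (Fin n → K)} (hD : IsSelfOrthogonal D) : (1 : Fin n → K) ∉ D := by
  intro h
  have := hD.dotProduct_eq_zero h h
  rw [one_dotProduct_one h2 hn] at this
  exact one_ne_zero this

theorem one_not_mem_span (h2 : (2 : K) = 0) (hn : Odd n) {r : ℕ} {t : Fin r → Fin n → K}
    (ht : ∀ i j, t i ⬝ᵥ t j = 0) : (1 : Fin n → K) ∉ Submodule.span K (Set.range t) := by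
  apply one_not_mem_of_isSelfOrthogonal h2 hn (isSelfOrthogonal_span _)
  rintro _ ⟨i, rfl⟩ _ ⟨j, rfl⟩
  exact ht i j

theorem linearIndependent_option_one (h2 : (2 : K) = 0) (hn : Odd n) {r : ℕ}
    {t : Fin r → Fin n → K} (hli : LinearIndependent K t) (ht : ∀ i j, t i ⬝ᵥ t j = 0) :
    LinearIndependent K (fun i : Option (Fin r) => i.elim 1 t) :=
  linearIndependent_option.2 ⟨hli, one_not_mem_span h2 hn ht⟩

/-- The vectors that extend an isotropic sequence are those of the orthogonal complement of the
sequence and the all-one vector that lie outside the span of the sequence. -/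
theorem card_isotropic_extensions [Finite K] (h2 : (2 : K) = 0) (hn : Odd n) {r : ℕ}
    {t : Fin r → Fin n → K} (hli : LinearIndependent K t) (ht : ∀ i j, t i ⬝ᵥ t j = 0) :
    (Nat.card {x // x ∉ Submodule.span K (Set.range t) ∧ (∀ j, t j ⬝ᵥ x = 0) ∧ 1 ⬝ᵥ x = 0} : ℚ) =
      (Nat.card K : ℚ) ^ (n - 1 - r) - (Nat.card K : ℚ) ^ r := by
  have hli' := linearIndependent_option_one h2 hn hli ht
  have hle : Submodule.span K (Set.range t) ≤ perp (fun i : Option (Fin r) => i.elim 1 t) := by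
    rw [Submodule.span_le]
    rintro _ ⟨j, rfl⟩
    rw [SetLike.mem_coe, mem_perp]
    rintro (_ | i)
    · exact (one_dotProduct_eq_zero_iff h2 _).2 (ht j j)
    · exact ht i j
  have h := cast_card_mem_not_mem hle
  rw [finrank_perp hli', finrank_span_eq_card hli, Fintype.card_option, Fintype.card_fin,
    show n - (r + 1) = n - 1 - r by omega] at h
  rw [← h]
  congr 1
  refine Nat.card_congr (Equiv.subtypeEquivRight fun x => ?_)
  rw [mem_perp, Option.forall]
  exact and_congr_right fun _ => and_comm

/-- Linearly independent, pairwise orthogonal, isotropic sequences. -/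
def IsotropicSeq (r : ℕ) (t : Fin r → Fin n → K) : Prop :=
  LinearIndependent K t ∧ ∀ i j, t i ⬝ᵥ t j = 0

theorem isotropicSeq_snoc {r : ℕ} (t : Fin r → Fin n → K) (x : Fin n → K) :
    IsotropicSeq (r + 1) (Fin.snoc t x : Fin (r + 1) → Fin n → K) ↔
      IsotropicSeq r t ∧ x ∉ Submodule.span K (Set.range t) ∧ (∀ j, t j ⬝ᵥ x = 0) ∧
        x ⬝ᵥ x = 0 := by
  rw [IsotropicSeq, linearIndependent_finSnoc, IsotropicSeq]
  have : (∀ i j : Fin (r + 1), (Fin.snoc t x : Fin (r + 1) → Fin n → K) i ⬝ᵥ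
      (Fin.snoc t x : Fin (r + 1) → Fin n → K) j = 0) ↔
      (∀ i j, t i ⬝ᵥ t j = 0) ∧ (∀ j, t j ⬝ᵥ x = 0) ∧ x ⬝ᵥ x = 0 := by
    simp only [Fin.forall_fin_succ', Fin.snoc_castSucc, Fin.snoc_last, forall_and]
    simp only [dotProduct_comm x]
    tauto
  rw [this]
  tauto

theorem card_isotropicSeq [Finite K] (h2 : (2 : K) = 0) (hn : Odd n) (k : ℕ) :
    (Nat.card {t : Fin k → Fin n → K // IsotropicSeq k t} : ℚ) =
      ∏ r ∈ Finset.range k, ((Nat.card K : ℚ) ^ (n - 1 - r) - (Nat.card K : ℚ) ^ r) := by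
  refine card_sequences (fun r t => IsotropicSeq r t) _ k ?_ ?_ ?_
  · exact fun t => ⟨linearIndependent_empty_type, fun i => i.elim0⟩
  · exact fun r _ t x h => ((isotropicSeq_snoc t x).1 h).1
  · intro r _ t ht
    rw [← card_isotropic_extensions h2 hn ht.1 ht.2]
    congr 1
    refine Nat.card_congr (Equiv.subtypeEquivRight fun x => ?_)
    rw [isotropicSeq_snoc, one_dotProduct_eq_zero_iff h2]
    exact and_iff_right ht

/-- The number of bases adapted to a flag. -/
theorem card_adaptedSeq [Finite K] {V : Type*} [AddCommGroup V] [Module K V] [Finite V]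
    (k : ℕ) (T : ℕ → Submodule K V) (hT : ∀ i r, i ≤ r → r < k → T i ≤ T r) :
    (Nat.card {t : Fin k → V // LinearIndependent K t ∧ ∀ i : Fin k, t i ∈ T i} : ℚ) =
      ∏ r ∈ Finset.range k, ((Nat.card K : ℚ) ^ Module.finrank K (T r) - (Nat.card K : ℚ) ^ r) := by
  have hsnoc : ∀ (r : ℕ) (t : Fin r → V) (x : V),
      (LinearIndependent K (Fin.snoc t x : Fin (r + 1) → V) ∧
        ∀ i : Fin (r + 1), (Fin.snoc t x : Fin (r + 1) → V) i ∈ T i) ↔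
      (LinearIndependent K t ∧ ∀ i : Fin r, t i ∈ T i) ∧
        x ∉ Submodule.span K (Set.range t) ∧ x ∈ T r := by
    intro r t x
    rw [linearIndependent_finSnoc, Fin.forall_fin_succ']
    simp only [Fin.snoc_castSucc, Fin.snoc_last, Fin.val_castSucc, Fin.val_last]
    tauto
  refine card_sequences (fun r t => LinearIndependent K t ∧ ∀ i : Fin r, t i ∈ T i) _ k ?_ ?_ ?_
  · exact fun t => ⟨linearIndependent_empty_type, fun i => i.elim0⟩
  · exact fun r _ t x h => ((hsnoc r t x).1 h).1
  · intro r hr t ht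
    have hle : Submodule.span K (Set.range t) ≤ T r := by
      rw [Submodule.span_le]
      rintro _ ⟨i, rfl⟩
      exact hT i r i.2.le hr (ht.2 i)
    have h := cast_card_mem_not_mem hle
    rw [finrank_span_eq_card ht.1, Fintype.card_fin] at h
    rw [← h]
    congr 1
    refine Nat.card_congr (Equiv.subtypeEquivRight fun x => ?_)
    rw [hsnoc]
    exact and_iff_right ht

/-- Double counting of the pairs of a chain and an adapted basis of it. -/
theorem numChains_mul (K : Type*) [Field K] [Finite K] (h2 : (2 : K) = 0) (hn : Odd n)
    (lam : ℕ → ℕ) (k s : ℕ) :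
    (numChains K n lam k s : ℚ) * ∏ r ∈ Finset.range (partialSum lam k),
        ((Nat.card K : ℚ) ^ partialSum lam (blockIndex lam k r + 1) - (Nat.card K : ℚ) ^ r) =
      ∏ r ∈ Finset.range (partialSum lam k),
        ((Nat.card K : ℚ) ^ (n - 1 - r) - (Nat.card K : ℚ) ^ r) := by
  have := finite_submodule (A := K) (M := Fin n → K)
  rw [← card_isotropicSeq h2 hn]
  symm
  refine cast_card_subtype_of_fibers
    (fun (t : Fin (partialSum lam k) → Fin n → K) (i : Fin (k + 1)) =>
      Submodule.span K (t '' {r | (r : ℕ) < partialSum lam i})) _ _ ?_ _ ?_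
  · rintro t ⟨hli, ht⟩
    have hso : ∀ i : Fin (k + 1), IsSelfOrthogonal
        (Submodule.span K (t '' {r | (r : ℕ) < partialSum lam i})) := by
      intro i
      apply isSelfOrthogonal_span
      rintro _ ⟨a, -, rfl⟩ _ ⟨b, -, rfl⟩
      exact ht a b
    refine ⟨fun i j hij => ?_, hso, fun i => ?_, fun i _ => ?_⟩
    · refine Submodule.span_mono (Set.image_mono fun r hr => ?_)
      exact lt_of_lt_of_le hr (partialSum_mono lam hij)
    · exact finrank_span_prefix hli (partialSum_mono lam (Nat.le_of_lt_succ i.2))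
    · exact one_not_mem_of_isSelfOrthogonal h2 hn (hso i)
  · rintro D ⟨hmono, hso, hdim, -⟩
    let T : ℕ → Submodule K (Fin n → K) := fun r =>
      D ⟨min (blockIndex lam k r + 1) k, by omega⟩
    have hβ : ∀ r < partialSum lam k, min (blockIndex lam k r + 1) k = blockIndex lam k r + 1 :=
      fun r hr => by have := blockIndex_lt lam hr; omega
    have hcount := card_adaptedSeq (partialSum lam k) T (fun i r hir _ => hmono (by
      have := blockIndex_mono lam k hir
      rw [Fin.mk_le_mk]
      omega))
    have hT : ∀ r ∈ Finset.range (partialSum lam k),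
        (Nat.card K : ℚ) ^ Module.finrank K (T r) - (Nat.card K : ℚ) ^ r =
        (Nat.card K : ℚ) ^ partialSum lam (blockIndex lam k r + 1) - (Nat.card K : ℚ) ^ r := by
      intro r hr
      rw [hdim]
      simp only [hβ r (Finset.mem_range.1 hr)]
    rw [Finset.prod_congr rfl hT] at hcount
    rw [← hcount]
    congr 1
    refine Nat.card_congr (Equiv.subtypeEquivRight fun t => ?_)
    constructor
    · rintro ⟨⟨hli, -⟩, rfl⟩
      refine ⟨hli, fun r => Submodule.subset_span ⟨r, ?_, rfl⟩⟩
      simp only [Set.mem_ofPred_eq, hβ r r.2]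
      exact lt_partialSum_blockIndex lam r.2
    · rintro ⟨hli, ht⟩
      refine ⟨⟨hli, fun i j => ?_⟩, ?_⟩
      · have hle : ∀ r, T r ≤ D (Fin.last k) := fun r => hmono (Fin.le_last _)
        exact (hso (Fin.last k)).dotProduct_eq_zero (hle _ (ht i)) (hle _ (ht j))
      · funext i
        have hik := Nat.le_of_lt_succ i.2
        apply Submodule.eq_of_le_of_finrank_eq
        · rw [Submodule.span_le]
          rintro _ ⟨r, hr, rfl⟩
          refine hmono ?_ (ht r)
          have := (blockIndex_lt_iff lam hik r).2 hr
          rw [Fin.le_def]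
          simp only
          omega
        · rw [hdim]
          exact finrank_span_prefix hli (partialSum_mono lam hik)

end FieldCounts
/-! ### Generator sequences of self-orthogonal codes -/

section RingCounts

variable {R : Type*} [CommRing R] [IsLocalRing R] {u : R} {e m κ : ℕ} {n : ℕ}

/-- Sequences `v` with independent reductions for which the vectors `u ^ β r • v r` are pairwise
orthogonal and isotropic, that is, generate a self-orthogonal code. -/
def GeneratorSeq (u : R) (β : ℕ → ℕ) (r : ℕ) (v : Fin r → Fin n → R) : Prop :=
  LinearIndependent (IsLocalRing.ResidueField R) (fun i => red (v i)) ∧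
    ∀ i j : Fin r, u ^ (β i + β j) * (v i ⬝ᵥ v j) = 0

theorem red_snoc {r : ℕ} (v : Fin r → Fin n → R) (x : Fin n → R) :
    (fun i => red ((Fin.snoc v x : Fin (r + 1) → Fin n → R) i)) =
      (Fin.snoc (fun i => red (v i)) (red x) : Fin (r + 1) → _) := by
  funext i
  refine Fin.lastCases ?_ (fun i => ?_) i <;> simp

theorem generatorSeq_snoc {β : ℕ → ℕ} {r : ℕ} (v : Fin r → Fin n → R) (x : Fin n → R) :
    GeneratorSeq u β (r + 1) (Fin.snoc v x : Fin (r + 1) → Fin n → R) ↔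
      GeneratorSeq u β r v ∧
        red x ∉ Submodule.span (IsLocalRing.ResidueField R) (Set.range fun i => red (v i)) ∧
        (∀ j : Fin r, u ^ (β j + β r) * (v j ⬝ᵥ x) = 0) ∧ u ^ (β r + β r) * (x ⬝ᵥ x) = 0 := by
  rw [GeneratorSeq, red_snoc, linearIndependent_finSnoc, GeneratorSeq]
  have : (∀ i j : Fin (r + 1), u ^ (β i + β j) * ((Fin.snoc v x : Fin (r + 1) → Fin n → R) i ⬝ᵥ
      (Fin.snoc v x : Fin (r + 1) → Fin n → R) j) = 0) ↔
      (∀ i j : Fin r, u ^ (β i + β j) * (v i ⬝ᵥ v j) = 0) ∧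
        (∀ j : Fin r, u ^ (β j + β r) * (v j ⬝ᵥ x) = 0) ∧ u ^ (β r + β r) * (x ⬝ᵥ x) = 0 := by
    simp only [Fin.forall_fin_succ', Fin.snoc_castSucc, Fin.snoc_last, forall_and,
      Fin.val_castSucc, Fin.val_last]
    simp only [dotProduct_comm x, add_comm (β r)]
    tauto
  rw [this]
  tauto

theorem IsEvenChainRing.residue_eq_zero_of_pow_mul (hR : IsEvenChainRing R u e m κ) {k : ℕ}
    (hk : k < e) {y : R} (h : u ^ k * y = 0) : IsLocalRing.residue R y = 0 := by
  rw [hR.pow_mul_eq_zero_iff hk.le] at h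
  exact hR.residue_of_dvd ((dvd_pow_self u (by omega)).trans h)

theorem IsEvenChainRing.pow_eq_zero_of_le (hR : IsEvenChainRing R u e m κ) {k : ℕ} (hk : e ≤ k) :
    u ^ k = 0 := by
  rw [← Nat.sub_add_cancel hk, pow_add, hR.pow_eq_zero, mul_zero]

/-- The number of conditions modulo the maximal ideal that `u ^ k * (v ⬝ᵥ x) = 0` imposes on a vector
`x` with prescribed reduction orthogonal to that of `v`. The subtraction truncates: there is no
condition for `k ≥ e`. -/
def linCodim (e k : ℕ) : ℕ := e - 1 - k

theorem card_orthogonal_lifts (hR : IsEvenChainRing R u e m κ) {r : ℕ} (v : Fin r → Fin n → R)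
    (hv : LinearIndependent (IsLocalRing.ResidueField R) fun i => red (v i)) (k : ℕ → ℕ)
    (t : Fin n → R) (ht : ∀ j : Fin r, k j < e → red (v j) ⬝ᵥ red t = 0) :
    Nat.card {x : Fin n → R // red x = red t ∧ ∀ j : Fin r, u ^ k j * (v j ⬝ᵥ x) = 0} *
      (2 ^ m) ^ (∑ j ∈ Finset.range r, linCodim e (k j)) = (2 ^ m) ^ ((e - 1) * n) := by
  have h := card_linear_conditions hR v hv t (fun j y => u ^ k j * y = 0)
    (fun j => (2 ^ m) ^ min (k j) (e - 1)) (fun x hx j =>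
      hR.card_annihilator_shift _ _ fun hk => by
        rw [← hR.residue_eq_zero_iff, residue_dotProduct, hx]
        exact ht j hk)
  rw [Fintype.card_fin, Finset.prod_pow_eq_pow_sum, ← pow_mul (2 ^ m) (e - 1) r,
    ← pow_mul (2 ^ m) (e - 1) n] at h
  have hsum : ∑ j ∈ Finset.range r, linCodim e (k j) + ∑ j : Fin r, min (k j) (e - 1) =
      (e - 1) * r := by
    rw [Finset.sum_range, ← Finset.sum_add_distrib,
      Finset.sum_congr rfl (g := fun _ => e - 1) (fun j _ => by rw [linCodim]; omega)]
    simp [mul_comm]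
  apply Nat.eq_of_mul_eq_mul_right
    (show 0 < (2 ^ m) ^ ∑ j : Fin r, min (k j) (e - 1) by positivity)
  rw [mul_assoc, ← pow_add, hsum, h]

/-- The exponent of `2 ^ m` in the number of generator vectors `x` with a given reduction that extend
a sequence of length `r`. -/
def liftExponent (e n κ : ℕ) (β : ℕ → ℕ) (r : ℕ) : ℤ :=
  ((e - 1) * n : ℕ) - ((∑ j ∈ Finset.range r, linCodim e (β j + β r) +
    if 2 * β r < e then normCodim κ (e - 2 * β r) else 0 : ℕ) : ℤ)

/-- At a level below `e / 2` the lifts are subject to linear conditions and one norm condition. -/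
theorem card_isotropic_lifts (hR : IsEvenChainRing R u e m κ) (hκ : 2 ≤ κ) (hκe : Even κ)
    (hn : Odd n) {β : ℕ → ℕ} (hβ : Monotone β) {r : ℕ} (hr : 2 * β r < e) {v : Fin r → Fin n → R}
    (hv : GeneratorSeq u β r v) {t : Fin n → R}
    (ht : red t ∉ Submodule.span (IsLocalRing.ResidueField R) (Set.range fun i => red (v i)))
    (htv : ∀ j, red (v j) ⬝ᵥ red t = 0) (ht1 : 1 ⬝ᵥ red t = 0) :
    (Nat.card {x : Fin n → R // (red x = red t ∧ ∀ j : Fin r, u ^ (β j + β r) * (v j ⬝ᵥ x) = 0) ∧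
      u ^ (β r + β r) * (x ⬝ᵥ x) = 0} : ℚ) = ((2 : ℚ) ^ m) ^ liftExponent e n κ β r := by
  have h2 := hR.residue_two (by omega)
  have hvv : ∀ i j, red (v i) ⬝ᵥ red (v j) = 0 := fun i j => by
    rw [← residue_dotProduct]
    have h1 := hβ (show (i : ℕ) ≤ r from i.2.le)
    have h2 := hβ (show (j : ℕ) ≤ r from j.2.le)
    exact hR.residue_eq_zero_of_pow_mul (by omega) (hv.2 i j)
  have hli : LinearIndependent (IsLocalRing.ResidueField R)
      fun i : Option (Option (Fin r)) => red (i.elim t fun i => i.elim 1 v) := by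
    rw [linearIndependent_option, linearIndependent_option]
    refine ⟨⟨hv.1, ?_⟩, ?_⟩
    · have := one_not_mem_span h2 hn hvv
      rw [← red_one] at this
      exact this
    · -- the all-one vector is orthogonal to everything in sight but itself
      intro hmem
      have hrange : Set.range ((fun i : Option (Option (Fin r)) =>
          red (i.elim t fun i => i.elim 1 v)) ∘ some) =
          insert 1 (Set.range fun i => red (v i)) := by
        ext x
        constructor
        · rintro ⟨_ | i, rfl⟩
          · exact Or.inl red_one
          · exact Or.inr ⟨i, rfl⟩
        · rintro (rfl | ⟨i, rfl⟩)
          · exact ⟨none, red_one⟩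
          · exact ⟨some i, rfl⟩
      rw [hrange, Submodule.mem_span_insert] at hmem
      obtain ⟨c, z, hz, hc⟩ := hmem
      have hz1 : (1 : Fin n → IsLocalRing.ResidueField R) ⬝ᵥ z = 0 := by
        rw [one_dotProduct_eq_zero_iff h2]
        have hso := isSelfOrthogonal_span (s := Set.range fun i => red (v i)) (by
          rintro _ ⟨i, rfl⟩ _ ⟨j, rfl⟩
          exact hvv i j)
        exact hso.dotProduct_eq_zero hz hz
      have hc' : red t = c • 1 + z := hc
      rw [hc', dotProduct_add, hz1, dotProduct_smul, one_dotProduct_one h2 hn] at ht1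
      have hc0 : c = 0 := by simpa using ht1
      rw [hc0, zero_smul, zero_add] at hc'
      exact ht (hc' ▸ hz)
  have h1 := card_norm_condition hR hκ hκe (show 1 ≤ e - 2 * β r by omega) (by omega) v t hli ht1
    (fun j y => u ^ (β j + β r) * y = 0)
  have h3 := card_orthogonal_lifts hR v hv.1 (fun j => β j + β r) t (fun j _ => htv j)
  rw [← h1, mul_assoc, ← pow_add, add_comm] at h3
  have h4 := cast_eq_zpow (by positivity) h3
  rw [liftExponent, if_pos hr]
  push_cast at h4 ⊢
  rw [← h4]
  congr 1
  refine Nat.card_congr (Equiv.subtypeEquivRight fun x => and_congr_right fun _ => ?_)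
  rw [hR.pow_mul_eq_zero_iff (by omega), show β r + β r = 2 * β r by ring]

/-- The number of reductions of the `r`-th vector of a generator sequence. At a level below `e / 2` the
reduction is isotropic and orthogonal to all earlier reductions; at a higher level it is only
orthogonal to those of complementary level. -/
def reductionCount (q : ℚ) (e n : ℕ) (lam : ℕ → ℕ) (r : ℕ) : ℚ :=
  if 2 * blockIndex lam e r < e then q ^ (n - 1 - r) - q ^ r
  else q ^ (n - partialSum lam (e - blockIndex lam e r)) - q ^ r

theorem card_generatorSeq_extensions (hR : IsEvenChainRing R u e m κ) (hκ : 2 ≤ κ)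
    (hκe : Even κ) (hn : Odd n) (lam : ℕ → ℕ) {r : ℕ} (hr : r < partialSum lam e)
    {v : Fin r → Fin n → R} (hv : GeneratorSeq u (blockIndex lam e) r v) :
    (Nat.card {x // GeneratorSeq u (blockIndex lam e) (r + 1)
      (Fin.snoc v x : Fin (r + 1) → Fin n → R)} : ℚ) =
      reductionCount (2 ^ m) e n lam r *
        ((2 : ℚ) ^ m) ^ liftExponent e n κ (blockIndex lam e) r := by
  have := hR.finite
  have := hR.finite_residueField
  have h2 := hR.residue_two (by omega)
  have hq : (Nat.card (IsLocalRing.ResidueField R) : ℚ) = 2 ^ m := by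
    rw [hR.card_residueField]; push_cast; rfl
  obtain ⟨β, hβ⟩ : ∃ β, β = blockIndex lam e := ⟨_, rfl⟩
  have hmono : Monotone β := hβ ▸ blockIndex_mono lam e
  rw [← hβ] at hv ⊢
  have hβr : ∀ j : Fin r, β j ≤ β r := fun j => hmono j.2.le
  have hsnoc : ∀ x, GeneratorSeq u β (r + 1) (Fin.snoc v x : Fin (r + 1) → Fin n → R) ↔
        red x ∉ Submodule.span (IsLocalRing.ResidueField R) (Set.range fun i => red (v i)) ∧
        (∀ j : Fin r, u ^ (β j + β r) * (v j ⬝ᵥ x) = 0) ∧ u ^ (β r + β r) * (x ⬝ᵥ x) = 0 :=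
    fun x => by rw [generatorSeq_snoc, and_iff_right hv]
  simp only [hsnoc]
  have hres : ∀ x : Fin n → R, (∀ j : Fin r, u ^ (β j + β r) * (v j ⬝ᵥ x) = 0) →
      ∀ j : Fin r, β j + β r < e → red (v j) ⬝ᵥ red x = 0 := fun x hx j hj => by
    rw [← residue_dotProduct]
    exact hR.residue_eq_zero_of_pow_mul hj (hx j)
  by_cases hlt : 2 * β r < e
  · have hvv : ∀ i j, red (v i) ⬝ᵥ red (v j) = 0 := fun i j => by
      rw [← residue_dotProduct]
      have := hβr i
      have := hβr j
      exact hR.residue_eq_zero_of_pow_mul (by omega) (hv.2 i j)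
    rw [reductionCount, ← hβ, if_pos hlt, ← hq,
      ← card_isotropic_extensions h2 hn hv.1 hvv, hq]
    refine cast_card_subtype_of_fibers red _ _ ?_ _ ?_
    · rintro x ⟨h3, h4, h5⟩
      refine ⟨h3, fun j => hres x h4 j (by have := hβr j; omega), ?_⟩
      rw [one_dotProduct_eq_zero_iff h2, ← residue_dotProduct]
      exact hR.residue_eq_zero_of_pow_mul (by omega) h5
    · rintro t ⟨h3, h4, h5⟩
      obtain ⟨t, rfl⟩ := red_surjective t
      rw [← card_isotropic_lifts hR hκ hκe hn hmono hlt hv h3 h4 h5]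
      congr 1
      refine Nat.card_congr (Equiv.subtypeEquivRight fun x => ?_)
      constructor
      · rintro ⟨⟨_, h7, h8⟩, h6⟩
        exact ⟨⟨h6, h7⟩, h8⟩
      · rintro ⟨⟨h6, h7⟩, h8⟩
        exact ⟨⟨by rwa [h6], h7, h8⟩, h6⟩
  · -- only the earlier vectors of low level impose conditions on the reduction
    have hβe : β r < e := hβ ▸ blockIndex_lt lam hr
    obtain ⟨L, hL⟩ : ∃ L, L = partialSum lam (e - β r) := ⟨_, rfl⟩
    have hLiff : ∀ j : ℕ, j < L ↔ β j + β r < e := fun j => by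
      rw [hL, ← blockIndex_lt_iff lam (Nat.sub_le _ _), ← hβ]; omega
    have hLr : L ≤ r := by
      by_contra hcon
      have := (hLiff r).1 (by omega)
      omega
    let a : Fin L → Fin n → IsLocalRing.ResidueField R := fun j => red (v (Fin.castLE hLr j))
    have ha : LinearIndependent (IsLocalRing.ResidueField R) a :=
      hv.1.comp _ (Fin.castLE_injective hLr)
    have hle : Submodule.span (IsLocalRing.ResidueField R) (Set.range fun i => red (v i)) ≤
        perp a := by
      rw [Submodule.span_le]
      rintro _ ⟨i, rfl⟩
      rw [SetLike.mem_coe, mem_perp]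
      intro j
      simp only [a]
      rw [← residue_dotProduct]
      have h3 := (hLiff j).1 j.2
      have h4 := hβr i
      exact hR.residue_eq_zero_of_pow_mul (by rw [Fin.val_castLE]; omega) (hv.2 _ _)
    have hcard := cast_card_mem_not_mem hle
    rw [finrank_perp ha, finrank_span_eq_card hv.1, Fintype.card_fin, Fintype.card_fin] at hcard
    rw [reductionCount, ← hβ, if_neg hlt, ← hL, ← hq, ← hcard, hq]
    have hnorm : u ^ (β r + β r) = 0 := hR.pow_eq_zero_of_le (by omega)
    refine cast_card_subtype_of_fibers red _ _ ?_ _ ?_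
    · rintro x ⟨h3, h4, -⟩
      refine ⟨h3, mem_perp.2 fun j => hres x h4 _ ((hLiff _).1 j.2)⟩
    · rintro t ⟨h3, h4⟩
      obtain ⟨t, rfl⟩ := red_surjective t
      have h5 := card_orthogonal_lifts hR v hv.1 (fun j => β j + β r) t (fun j hj =>
        mem_perp.1 h4 ⟨j, (hLiff j).2 hj⟩)
      have h6 := cast_eq_zpow (by positivity) h5
      rw [liftExponent, if_neg hlt, add_zero]
      push_cast at h6 ⊢
      rw [← h6]
      congr 1
      refine Nat.card_congr (Equiv.subtypeEquivRight fun x => ?_)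
      constructor
      · rintro ⟨⟨_, h8, -⟩, h7⟩
        exact ⟨h7, h8⟩
      · rintro ⟨h7, h8⟩
        exact ⟨⟨by rwa [h7], h8, by rw [hnorm, zero_mul]⟩, h7⟩

theorem card_generatorSeq (hR : IsEvenChainRing R u e m κ) (hκ : 2 ≤ κ) (hκe : Even κ)
    (hn : Odd n) (lam : ℕ → ℕ) :
    (Nat.card {v : Fin (partialSum lam e) → Fin n → R //
      GeneratorSeq u (blockIndex lam e) (partialSum lam e) v} : ℚ) =
      ∏ r ∈ Finset.range (partialSum lam e), (reductionCount (2 ^ m) e n lam r *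
        ((2 : ℚ) ^ m) ^ liftExponent e n κ (blockIndex lam e) r) := by
  have := hR.finite
  refine card_sequences (fun r v => GeneratorSeq u (blockIndex lam e) r v) _ _ ?_ ?_ ?_
  · exact fun v => ⟨linearIndependent_empty_type, fun i => i.elim0⟩
  · exact fun r _ v x h => ((generatorSeq_snoc v x).1 h).1
  · exact fun r hr v hv => card_generatorSeq_extensions hR hκ hκe hn lam hr hv

/-- The generator sequences of a code: the reductions form a basis adapted to the torsion codes, and
each lift is free modulo `{v | red v = 0 ∧ u ^ j • v ∈ C}`. -/
theorem card_generators_of_code (hR : IsEvenChainRing R u e m κ) (lam : ℕ → ℕ)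
    {C : Submodule R (Fin n → R)} (hC : HasTorsionDims u e lam C) :
    (Nat.card {v : Fin (partialSum lam e) → Fin n → R //
      LinearIndependent (IsLocalRing.ResidueField R) (fun i => red (v i)) ∧
        ∀ i : Fin (partialSum lam e), u ^ blockIndex lam e i • v i ∈ C} : ℚ) =
      ∏ r ∈ Finset.range (partialSum lam e),
        (((2 : ℚ) ^ m) ^ partialSum lam (blockIndex lam e r + 1) - ((2 : ℚ) ^ m) ^ r) *
          ((2 : ℚ) ^ m) ^ colonExponent lam e n (blockIndex lam e r) := by
  have := hR.finite
  have := hR.finite_residueField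
  have hq : (Nat.card (IsLocalRing.ResidueField R) : ℚ) = 2 ^ m := by
    rw [hR.card_residueField]; push_cast; rfl
  obtain ⟨β, hβ⟩ : ∃ β, β = blockIndex lam e := ⟨_, rfl⟩
  have hmono : Monotone β := hβ ▸ blockIndex_mono lam e
  rw [← hβ]
  have hsnoc : ∀ (r : ℕ) (v : Fin r → Fin n → R) (x : Fin n → R),
      (LinearIndependent (IsLocalRing.ResidueField R)
          (fun i => red ((Fin.snoc v x : Fin (r + 1) → Fin n → R) i)) ∧
        ∀ i : Fin (r + 1), u ^ β i • (Fin.snoc v x : Fin (r + 1) → Fin n → R) i ∈ C) ↔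
      (LinearIndependent (IsLocalRing.ResidueField R) (fun i => red (v i)) ∧
        ∀ i : Fin r, u ^ β i • v i ∈ C) ∧
        red x ∉ Submodule.span (IsLocalRing.ResidueField R) (Set.range fun i => red (v i)) ∧
          u ^ β r • x ∈ C := by
    intro r v x
    rw [red_snoc, linearIndependent_finSnoc, Fin.forall_fin_succ']
    simp only [Fin.snoc_castSucc, Fin.snoc_last, Fin.val_castSucc, Fin.val_last]
    tauto
  refine card_sequences (fun r v => LinearIndependent (IsLocalRing.ResidueField R)
    (fun i => red (v i)) ∧ ∀ i : Fin r, u ^ β i • v i ∈ C) _ _ ?_ ?_ ?_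
  · exact fun v => ⟨linearIndependent_empty_type, fun i => i.elim0⟩
  · exact fun r _ v x h => ((hsnoc r v x).1 h).1
  · intro r hr v hv
    simp only [hsnoc, hv, true_and, implies_true]
    have hβe : β r < e := hβ ▸ blockIndex_lt lam hr
    have hle : Submodule.span (IsLocalRing.ResidueField R) (Set.range fun i => red (v i)) ≤
        torsionCode u (β r) C := by
      rw [Submodule.span_le]
      rintro _ ⟨i, rfl⟩
      exact torsionCode_mono C (hmono i.2.le) ⟨v i, hv.2 i, rfl⟩
    have hcard := cast_card_mem_not_mem hle
    rw [hC _ hβe, finrank_span_eq_card hv.1, Fintype.card_fin, hq] at hcard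
    rw [← hcard]
    refine cast_card_subtype_of_fibers red _ _ ?_ _ ?_
    · rintro x ⟨h3, h4⟩
      exact ⟨h3, x, h4, rfl⟩
    · rintro _ ⟨h3, t, ht, rfl⟩
      have h5 := card_colon hR lam hC hβe
      have h6 : ((2 : ℚ) ^ m) ^ colonExponent lam e n (β r) =
          (((2 ^ m) ^ colonExponent lam e n (β r) : ℕ) : ℚ) := by push_cast; rfl
      rw [h6, ← h5]
      congr 1
      refine Nat.card_congr ((Equiv.subRight t).subtypeEquiv fun x => ?_)
      rw [Equiv.subRight_apply, red_sub, sub_eq_zero, smul_sub]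
      constructor
      · rintro ⟨⟨_, h7⟩, h8⟩
        exact ⟨h8, C.sub_mem h7 ht⟩
      · rintro ⟨h8, h7⟩
        exact ⟨⟨by rwa [h8], by simpa using C.add_mem h7 ht⟩, h8⟩

/-- Double counting of the pairs of a self-orthogonal code and a generator sequence of it. -/
theorem numSelfOrthogonal_mul (hR : IsEvenChainRing R u e m κ) (hκ : 2 ≤ κ) (hκe : Even κ)
    (hn : Odd n) (lam : ℕ → ℕ) (hN : partialSum lam e ≤ n) :
    (numSelfOrthogonal R u e n lam : ℚ) * ∏ r ∈ Finset.range (partialSum lam e),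
        (((2 : ℚ) ^ m) ^ partialSum lam (blockIndex lam e r + 1) - ((2 : ℚ) ^ m) ^ r) *
          ((2 : ℚ) ^ m) ^ colonExponent lam e n (blockIndex lam e r) =
      ∏ r ∈ Finset.range (partialSum lam e), (reductionCount (2 ^ m) e n lam r *
        ((2 : ℚ) ^ m) ^ liftExponent e n κ (blockIndex lam e) r) := by
  have := hR.finite
  have := finite_submodule (A := R) (M := Fin n → R)
  rw [← card_generatorSeq hR hκ hκe hn]
  symm
  refine cast_card_subtype_of_fibers
    (generatedCode u (fun r : Fin (partialSum lam e) => blockIndex lam e r)) _ _ ?_ _ ?_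
  · rintro v ⟨hli, hv⟩
    refine ⟨isSelfOrthogonal_span ?_, (isOfType_iff hR lam hN _).2
      (hasTorsionDims_generatedCode hR lam hli)⟩
    rintro _ ⟨i, rfl⟩ _ ⟨j, rfl⟩
    rw [smul_dotProduct, dotProduct_smul, smul_eq_mul, smul_eq_mul, ← mul_assoc, ← pow_add]
    exact hv i j
  · rintro C ⟨hso, htype⟩
    have hC := (isOfType_iff hR lam hN C).1 htype
    rw [← card_generators_of_code hR lam hC]
    congr 1
    refine Nat.card_congr (Equiv.subtypeEquivRight fun v => ?_)
    constructor
    · rintro ⟨⟨hli, -⟩, rfl⟩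
      exact ⟨hli, fun i => Submodule.subset_span ⟨i, rfl⟩⟩
    · rintro ⟨hli, hv⟩
      refine ⟨⟨hli, fun i j => ?_⟩, generatedCode_eq hR lam hli hC hv⟩
      have := hso.dotProduct_eq_zero (hv i) (hv j)
      rwa [smul_dotProduct, dotProduct_smul, smul_eq_mul, smul_eq_mul, ← mul_assoc,
        ← pow_add] at this

end RingCounts
/-! ### The exponent -/

section ExponentIdentity

theorem sum_blockIndex_lt (lam : ℕ → ℕ) {e p : ℕ} (hp : p ≤ e) :
    ∑ r ∈ Finset.range (partialSum lam e), (if blockIndex lam e r < p then (1 : ℤ) else 0) =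
      partialSum lam p := by
  simp only [blockIndex_lt_iff lam hp]
  rw [Finset.sum_boole]
  have : (Finset.range (partialSum lam e)).filter (· < partialSum lam p) =
      Finset.range (partialSum lam p) := by
    have := partialSum_mono lam hp
    ext r
    simp only [Finset.mem_filter, Finset.mem_range]
    omega
  rw [this, Finset.card_range]

theorem sum_sum_blockIndex_lt (lam : ℕ → ℕ) {e : ℕ} {s : Finset ℕ} (hs : ∀ p ∈ s, p ≤ e)
    (h : ℕ → ℤ) :
    ∑ r ∈ Finset.range (partialSum lam e), ∑ p ∈ s, (if blockIndex lam e r < p then h p else 0) =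
      ∑ p ∈ s, partialSum lam p * h p := by
  rw [Finset.sum_comm]
  refine Finset.sum_congr rfl fun p hp => ?_
  rw [← sum_blockIndex_lt lam (hs p hp), Finset.sum_mul]
  refine Finset.sum_congr rfl fun r _ => ?_
  split_ifs <;> simp

theorem sum_Icc_indicator (N x : ℕ) :
    ∑ p ∈ Finset.Icc 1 N, (if x < p then (1 : ℤ) else 0) = ((N - x : ℕ) : ℤ) := by
  rw [Finset.sum_boole]
  have : (Finset.Icc 1 N).filter (x < ·) = Finset.Icc (x + 1) N := by
    ext; simp only [Finset.mem_filter, Finset.mem_Icc]; omega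
  rw [this, Nat.card_Icc]
  congr 1
  omega

theorem sum_range_sum_range_symm (G : ℕ → ℕ → ℤ) (hG : ∀ i j, G i j = G j i) (N : ℕ) :
    ∑ r ∈ Finset.range N, ∑ j ∈ Finset.range N, G r j =
      2 * ∑ r ∈ Finset.range N, ∑ j ∈ Finset.range r, G j r + ∑ r ∈ Finset.range N, G r r := by
  induction N with
  | zero => simp
  | succ N ih =>
    simp only [Finset.sum_range_succ, Finset.sum_add_distrib, ih]
    rw [Finset.sum_congr rfl fun j _ => hG N j]
    ring

theorem linCodim_add (e x y : ℕ) : (linCodim e (x + y) : ℤ) =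
    ∑ p ∈ Finset.Icc 1 (e - 1), (if x < p then (if y < e - p then (1 : ℤ) else 0) else 0) := by
  simp only [← ite_and]
  rw [Finset.sum_boole]
  have : (Finset.Icc 1 (e - 1)).filter (fun p => x < p ∧ y < e - p) =
      Finset.Icc (x + 1) (e - 1 - y) := by
    ext; simp only [Finset.mem_filter, Finset.mem_Icc]; omega
  rw [this, Nat.card_Icc, linCodim]
  congr 1
  omega

theorem sum_sum_linCodim (lam : ℕ → ℕ) (e : ℕ) :
    ∑ r ∈ Finset.range (partialSum lam e), ∑ j ∈ Finset.range (partialSum lam e),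
        (linCodim e (blockIndex lam e r + blockIndex lam e j) : ℤ) =
      ∑ p ∈ Finset.Icc 1 (e - 1), (partialSum lam p : ℤ) * partialSum lam (e - p) := by
  have h1 : ∀ r, ∑ j ∈ Finset.range (partialSum lam e),
      (linCodim e (blockIndex lam e r + blockIndex lam e j) : ℤ) =
      ∑ p ∈ Finset.Icc 1 (e - 1),
        (if blockIndex lam e r < p then (partialSum lam (e - p) : ℤ) else 0) := by
    intro r
    simp only [linCodim_add]
    rw [Finset.sum_comm]
    refine Finset.sum_congr rfl fun p _ => ?_
    split_ifs
    · exact sum_blockIndex_lt lam (Nat.sub_le _ _)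
    · simp
  simp only [h1]
  refine sum_sum_blockIndex_lt lam (fun p hp => ?_) _
  rw [Finset.mem_Icc] at hp
  omega

theorem sum_Icc_split (e : ℕ) (he : 2 ≤ e) (F : ℕ → ℤ) :
    ∑ p ∈ Finset.Icc 1 (e - 1), F p =
      ∑ p ∈ Finset.Icc 1 (e / 2), F p +
        ∑ j ∈ Finset.Icc 1 (e / 2 - 1 + e % 2), F (e / 2 + j) := by
  have h1 : ∀ N, Finset.Icc 1 N = Finset.Ico 1 (N + 1) := fun N => by
    ext; simp only [Finset.mem_Icc, Finset.mem_Ico]; omega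
  rw [h1, h1, h1, Finset.sum_Ico_add (fun j => F j) 1 _ (e / 2),
    show e / 2 - 1 + e % 2 + 1 + e / 2 = e - 1 + 1 by omega, add_comm 1 (e / 2)]
  exact (Finset.sum_Ico_consecutive _ (by omega) (by omega)).symm

/-- Pairing the terms for `p` and `e - p`; the middle term is alone when `e` is even. -/
theorem sum_mul_reflect (e : ℕ) (he : 2 ≤ e) (L : ℕ → ℤ) :
    ∑ p ∈ Finset.Icc 1 (e - 1), L p * L (e - p) =
      2 * ∑ j ∈ Finset.Icc 1 (e / 2 - 1 + e % 2), L (e / 2 + j) * L (e / 2 + e % 2 - j) +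
        (1 - (e % 2 : ℕ)) * L (e / 2) ^ 2 := by
  rw [sum_Icc_split e he]
  have h1 : ∑ j ∈ Finset.Icc 1 (e / 2 - 1 + e % 2), L (e / 2 + j) * L (e - (e / 2 + j)) =
      ∑ j ∈ Finset.Icc 1 (e / 2 - 1 + e % 2), L (e / 2 + j) * L (e / 2 + e % 2 - j) := by
    refine Finset.sum_congr rfl fun j _ => ?_
    rw [show e - (e / 2 + j) = e / 2 + e % 2 - j by omega]
  have h2 : ∑ p ∈ Finset.Icc 1 (e / 2 - 1 + e % 2), L p * L (e - p) =
      ∑ j ∈ Finset.Icc 1 (e / 2 - 1 + e % 2), L (e / 2 + j) * L (e / 2 + e % 2 - j) := by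
    refine Finset.sum_nbij' (fun p => e / 2 + e % 2 - p) (fun j => e / 2 + e % 2 - j) ?_ ?_ ?_ ?_ ?_
    · intro p hp; rw [Finset.mem_Icc] at hp ⊢; omega
    · intro p hp; rw [Finset.mem_Icc] at hp ⊢; omega
    · intro p hp; rw [Finset.mem_Icc] at hp; omega
    · intro p hp; rw [Finset.mem_Icc] at hp; omega
    · intro p hp
      rw [Finset.mem_Icc] at hp
      rw [show e / 2 + (e / 2 + e % 2 - p) = e - p by omega,
        show e / 2 + e % 2 - (e / 2 + e % 2 - p) = p by omega, mul_comm]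
  rw [h1]
  rcases Nat.mod_two_eq_zero_or_one e with h | h
  · have h3 : ∑ p ∈ Finset.Icc 1 (e / 2), L p * L (e - p) =
        ∑ p ∈ Finset.Icc 1 (e / 2 - 1 + e % 2), L p * L (e - p) + L (e / 2) ^ 2 := by
      rw [show e / 2 = (e / 2 - 1 + e % 2) + 1 by omega, Finset.sum_Icc_succ_top (by omega),
        ← show e / 2 = (e / 2 - 1 + e % 2) + 1 by omega, show e - e / 2 = e / 2 by omega, sq]
    rw [h3, h2, h]
    push_cast
    ring
  · have h3 : e / 2 = e / 2 - 1 + e % 2 := by omega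
    rw [Finset.sum_congr (congrArg (Finset.Icc 1) h3) fun _ _ => rfl, h2, h]
    push_cast
    ring

theorem two_mul_normCodim (e κ b : ℕ) :
    2 * ((if 2 * b < e then normCodim κ (e - 2 * b) else 0 : ℕ) : ℤ) - linCodim e (b + b) =
      2 * ((e / 2 - κ / 2 - b : ℕ) : ℤ) -
        (1 - (e % 2 : ℕ)) * (if b < e / 2 then 1 else 0) := by
  unfold normCodim linCodim
  rcases Nat.mod_two_eq_zero_or_one e with h | h
  · rw [h]
    split_ifs <;> push_cast <;> omega
  · rw [h]
    split_ifs <;> push_cast <;> omega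

/-- The total exponent of a code count: the conditions are counted by summing indicators over the levels: exactly `Λ_p` rows have level
below `p`. -/
theorem sum_exponents (e n κ : ℕ) (he : 2 ≤ e) (lam : ℕ → ℕ) :
    ∑ r ∈ Finset.range (partialSum lam e), (liftExponent e n κ (blockIndex lam e) r -
      colonExponent lam e n (blockIndex lam e r)) = formulaExponent e n κ lam := by
  let β := blockIndex lam e
  let N := partialSum lam e
  let L : ℕ → ℤ := fun i => (partialSum lam i : ℤ)
  let θ : ℤ := (e % 2 : ℕ)
  have hβe : ∀ r ∈ Finset.range N, β r < e := fun r hr => blockIndex_lt lam (Finset.mem_range.1 hr)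
  have hle : ∀ p ∈ Finset.Icc 1 (e - 1), p ≤ e := fun p hp => by
    rw [Finset.mem_Icc] at hp; omega
  have hA : ∑ r ∈ Finset.range N, ((e - 1 - β r : ℕ) : ℤ) * n =
      ∑ p ∈ Finset.Icc 1 (e - 1), L p * n := by
    rw [← sum_sum_blockIndex_lt lam hle fun _ => (n : ℤ)]
    refine Finset.sum_congr rfl fun r _ => ?_
    rw [← sum_Icc_indicator, Finset.sum_mul]
    refine Finset.sum_congr rfl fun p _ => ?_
    simp only [β]
    split_ifs <;> simp
  have hB : ∑ r ∈ Finset.range N, ∑ p ∈ Finset.Icc (β r + 2) e, L p =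
      ∑ p ∈ Finset.Icc 1 (e - 1), L p * L (p + 1) := by
    rw [← sum_sum_blockIndex_lt lam hle fun p => L (p + 1)]
    refine Finset.sum_congr rfl fun r hr => ?_
    rw [← Finset.sum_filter]
    refine Finset.sum_nbij' (fun p => p - 1) (fun p => p + 1) ?_ ?_ ?_ ?_ ?_
    · intro p hp
      rw [Finset.mem_Icc] at hp
      rw [Finset.mem_filter, Finset.mem_Icc]
      simp only [β] at hp
      omega
    · intro p hp
      rw [Finset.mem_filter, Finset.mem_Icc] at hp
      rw [Finset.mem_Icc]
      simp only [β]
      omega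
    · intro p hp; rw [Finset.mem_Icc] at hp; omega
    · intro p hp; omega
    · intro p hp
      rw [Finset.mem_Icc] at hp
      rw [show p - 1 + 1 = p by omega]
  have hC := sum_range_sum_range_symm (fun i j => (linCodim e (β i + β j) : ℤ))
    (fun i j => by rw [add_comm]) N
  rw [sum_sum_linCodim, sum_mul_reflect e he L] at hC
  have hD : 2 * ∑ r ∈ Finset.range N,
        ((if 2 * β r < e then normCodim κ (e - 2 * β r) else 0 : ℕ) : ℤ) -
        ∑ r ∈ Finset.range N, (linCodim e (β r + β r) : ℤ) =
      2 * ∑ l ∈ Finset.Icc 1 (e / 2 - κ / 2), L l - (1 - θ) * L (e / 2) := by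
    have h1 : ∑ l ∈ Finset.Icc 1 (e / 2 - κ / 2), L l =
        ∑ r ∈ Finset.range N, ((e / 2 - κ / 2 - β r : ℕ) : ℤ) := by
      have := sum_sum_blockIndex_lt lam (e := e) (s := Finset.Icc 1 (e / 2 - κ / 2)) (fun p hp => by
        rw [Finset.mem_Icc] at hp; omega) fun _ => 1
      simp only [mul_one] at this
      rw [← this]
      exact Finset.sum_congr rfl fun r _ => sum_Icc_indicator _ _
    have h2 : L (e / 2) = _ := (sum_blockIndex_lt lam (show e / 2 ≤ e by omega)).symm
    rw [h1, h2, Finset.mul_sum, Finset.mul_sum,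
      Finset.mul_sum, ← Finset.sum_sub_distrib, ← Finset.sum_sub_distrib]
    exact Finset.sum_congr rfl fun r _ => two_mul_normCodim e κ (β r)
  have hE : 2 * (L (e / 2) * (L (e / 2) - 1) / 2) = L (e / 2) * (L (e / 2) - 1) :=
    Int.two_mul_ediv_two_of_even (Int.even_mul_pred_self _)
  have hF := sum_Icc_split e he fun p => L p * (n - L (p + 1))
  have hG : ∑ p ∈ Finset.Icc 1 (e - 1), L p * (n - L (p + 1)) =
      ∑ p ∈ Finset.Icc 1 (e - 1), L p * n - ∑ p ∈ Finset.Icc 1 (e - 1), L p * L (p + 1) := by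
    rw [← Finset.sum_sub_distrib]
    exact Finset.sum_congr rfl fun p _ => by ring
  have hH : ∑ j ∈ Finset.Icc 1 (e / 2 - 1 + e % 2),
      L (e / 2 + j) * (n - L (e / 2 + j + 1) - L (e / 2 + e % 2 - j)) =
      ∑ j ∈ Finset.Icc 1 (e / 2 - 1 + e % 2), L (e / 2 + j) * (n - L (e / 2 + j + 1)) -
      ∑ j ∈ Finset.Icc 1 (e / 2 - 1 + e % 2), L (e / 2 + j) * L (e / 2 + e % 2 - j) := by
    rw [← Finset.sum_sub_distrib]
    exact Finset.sum_congr rfl fun p _ => by ring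
  have hLHS : ∑ r ∈ Finset.range N, (liftExponent e n κ β r - colonExponent lam e n (β r)) =
      ∑ r ∈ Finset.range N, ((e - 1 - β r : ℕ) : ℤ) * n -
      ∑ r ∈ Finset.range N, ∑ p ∈ Finset.Icc (β r + 2) e, L p -
      ∑ r ∈ Finset.range N, ∑ j ∈ Finset.range r, (linCodim e (β j + β r) : ℤ) -
      ∑ r ∈ Finset.range N,
        ((if 2 * β r < e then normCodim κ (e - 2 * β r) else 0 : ℕ) : ℤ) := by
    rw [← Finset.sum_sub_distrib, ← Finset.sum_sub_distrib, ← Finset.sum_sub_distrib]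
    refine Finset.sum_congr rfl fun r hr => ?_
    have h1 : ((e - 1 - β r : ℕ) : ℤ) = ((e - 1 : ℕ) : ℤ) - β r :=
      Nat.cast_sub (by have := hβe r hr; omega)
    rw [liftExponent, colonExponent, h1]
    push_cast
    ring
  change ∑ r ∈ Finset.range N, (liftExponent e n κ β r - colonExponent lam e n (β r)) =
    ∑ i ∈ Finset.Icc 1 (e / 2), L i * (n - L (i + 1)) +
    ∑ j ∈ Finset.Icc 1 (e / 2 - 1 + e % 2),
      L (e / 2 + j) * (n - L (e / 2 + j + 1) - L (e / 2 + e % 2 - j)) -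
    ∑ l ∈ Finset.Icc 1 (e / 2 - κ / 2), L l - (1 - θ) * (L (e / 2) * (L (e / 2) - 1) / 2)
  rw [hLHS, hA, hB, hH]
  apply mul_left_cancel₀ (two_ne_zero (α := ℤ))
  simp only [θ] at hD ⊢
  linear_combination 2 * hF - 2 * hG + hC - hD + (1 - ((e % 2 : ℕ) : ℤ)) * hE

end ExponentIdentity

/-! ### Products of Gaussian binomial coefficients -/

section Products

theorem prod_blocks (lam : ℕ → ℕ) (e : ℕ) (h : ℕ → ℕ → ℚ) {i : ℕ} (hi : i ≤ e) :
    ∏ r ∈ Finset.range (partialSum lam i), h (blockIndex lam e r) r =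
      ∏ j ∈ Finset.range i, ∏ c ∈ Finset.range (lam (j + 1)), h j (partialSum lam j + c) := by
  induction i with
  | zero => simp [partialSum_zero]
  | succ i ih =>
    rw [partialSum_succ, Finset.prod_range_add, ih (by omega), Finset.prod_range_succ]
    congr 1
    refine Finset.prod_congr rfl fun c hc => ?_
    rw [Finset.mem_range] at hc
    have h1 := blockIndex_le_iff lam (show i < e by omega) (partialSum lam i + c)
    have h2 := blockIndex_lt_iff lam (show i ≤ e by omega) (partialSum lam i + c)
    rw [partialSum_succ] at h1
    congr 1
    omega

variable {q : ℚ}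

/-- Two forms of the order of the general linear group. -/
theorem prod_pow_sub_pow (a : ℕ) : ∏ i ∈ Finset.range a, (q ^ a - q ^ i) =
    ∏ i ∈ Finset.range a, q ^ i * (q ^ (i + 1) - 1) := by
  induction a with
  | zero => simp
  | succ a ih =>
    rw [Finset.prod_range_succ', Finset.prod_range_succ, ← ih]
    have : ∏ i ∈ Finset.range a, (q ^ (a + 1) - q ^ (i + 1)) =
        q ^ a * ∏ i ∈ Finset.range a, (q ^ a - q ^ i) := by
      have : ∀ i, q ^ (a + 1) - q ^ (i + 1) = q * (q ^ a - q ^ i) := fun i => by ring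
      simp only [this]
      rw [Finset.prod_mul_distrib, Finset.prod_const, Finset.card_range]
    rw [this]
    ring

theorem pow_sub_pow_ne_zero (hq : 1 < q) {a b : ℕ} (h : b < a) : q ^ a - q ^ b ≠ 0 :=
  (sub_pos.2 (pow_lt_pow_right₀ hq h)).ne'

theorem gaussBinom_shift (hq : 1 < q) (b d s : ℕ) :
    gaussBinom q b d = ∏ i ∈ Finset.range d, (q ^ (b + s) - q ^ (s + i)) /
      (q ^ (d + s) - q ^ (s + i)) := by
  refine Finset.prod_congr rfl fun i _ => ?_
  have hs : q ^ s ≠ 0 := by positivity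
  rw [pow_add, pow_add, pow_add, mul_comm (q ^ s), ← sub_mul, ← sub_mul, mul_div_mul_right _ _ hs]

/-- The number of bases of a space is the number of its flags with dimensions `Λ_j`, a product of
Gaussian binomial coefficients, times the number of bases adapted to one of them. -/
theorem prod_flag (hq : 1 < q) (lam : ℕ → ℕ) (k : ℕ) :
    ∏ i ∈ Finset.range (partialSum lam k), (q ^ partialSum lam k - q ^ i) =
      (∏ j ∈ Finset.range k, ∏ c ∈ Finset.range (lam (j + 1)),
        (q ^ partialSum lam (j + 1) - q ^ (partialSum lam j + c))) *
      ∏ j ∈ Finset.range k, gaussBinom q (partialSum lam (j + 1)) (lam (j + 1)) := by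
  induction k with
  | zero => simp [partialSum_zero]
  | succ k ih =>
    rw [Finset.prod_range_succ, Finset.prod_range_succ, mul_mul_mul_comm, ← ih, partialSum_succ]
    generalize partialSum lam k = a
    generalize lam (k + 1) = d
    have h1 : (∏ c ∈ Finset.range d, (q ^ (a + d) - q ^ (a + c))) * gaussBinom q (a + d) d =
        ∏ c ∈ Finset.range d, q ^ a * (q ^ (a + d) - q ^ c) := by
      rw [gaussBinom, ← Finset.prod_mul_distrib]
      refine Finset.prod_congr rfl fun c hc => ?_
      have := pow_sub_pow_ne_zero hq (Finset.mem_range.1 hc)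
      rw [mul_div_assoc', div_eq_iff this]
      ring
    rw [h1, add_comm a d, Finset.prod_range_add, Finset.prod_mul_distrib, Finset.prod_const,
      Finset.card_range]
    have h2 : ∏ i ∈ Finset.range a, (q ^ (d + a) - q ^ (d + i)) =
        (q ^ a) ^ d * ∏ i ∈ Finset.range a, (q ^ a - q ^ i) := by
      have : ∀ i, q ^ (d + a) - q ^ (d + i) = q ^ d * (q ^ a - q ^ i) := fun i => by ring
      simp only [this]
      rw [Finset.prod_mul_distrib, Finset.prod_const, Finset.card_range, ← pow_mul, ← pow_mul,
        mul_comm a d]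
    rw [h2]
    ring

end Products
/-! ### The enumeration formula -/

section Assembly

variable {q : ℚ}

/-- The closed form of the number `x` of chains. -/
theorem prod_flag_eq (hq : 1 < q) (lam : ℕ → ℕ) {n k : ℕ} (hk : 2 * partialSum lam k ≤ n) {x : ℚ}
    (hx : x * ∏ r ∈ Finset.range (partialSum lam k),
        (q ^ partialSum lam (blockIndex lam k r + 1) - q ^ r) =
      ∏ r ∈ Finset.range (partialSum lam k), (q ^ (n - 1 - r) - q ^ r)) :
    x = (∏ i ∈ Finset.range (partialSum lam k),
          ((q ^ (n - 1 - 2 * i) - 1) / (q ^ (i + 1) - 1))) *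
        ∏ j ∈ Finset.Icc 1 k, gaussBinom q (partialSum lam j) (lam j) := by
  have hIcc : ∏ j ∈ Finset.Icc 1 k, gaussBinom q (partialSum lam j) (lam j) =
      ∏ j ∈ Finset.range k, gaussBinom q (partialSum lam (j + 1)) (lam (j + 1)) := by
    rw [Finset.range_eq_Ico, Finset.prod_Ico_add' (fun j => gaussBinom q (partialSum lam j) (lam j))]
    rfl
  have hflag := prod_flag hq lam k
  rw [prod_blocks lam k (fun j r => q ^ partialSum lam (j + 1) - q ^ r) le_rfl] at hx
  have hA : ∏ j ∈ Finset.range k, ∏ c ∈ Finset.range (lam (j + 1)),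
      (q ^ partialSum lam (j + 1) - q ^ (partialSum lam j + c)) ≠ 0 := by
    refine Finset.prod_ne_zero_iff.2 fun j _ => Finset.prod_ne_zero_iff.2 fun c hc => ?_
    apply pow_sub_pow_ne_zero hq
    rw [partialSum_succ]
    have := Finset.mem_range.1 hc
    omega
  have hnum : ∏ r ∈ Finset.range (partialSum lam k), (q ^ (n - 1 - r) - q ^ r) =
      (∏ r ∈ Finset.range (partialSum lam k), q ^ r * (q ^ (r + 1) - 1)) *
      ∏ i ∈ Finset.range (partialSum lam k),
          ((q ^ (n - 1 - 2 * i) - 1) / (q ^ (i + 1) - 1)) := by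
    rw [← Finset.prod_mul_distrib]
    refine Finset.prod_congr rfl fun r hr => ?_
    have hr := Finset.mem_range.1 hr
    have h1 : q ^ (r + 1) - 1 ≠ 0 := by
      have := pow_sub_pow_ne_zero hq (Nat.succ_pos r)
      rwa [pow_zero] at this
    rw [mul_assoc, mul_div_cancel₀ _ h1, mul_sub, ← pow_add, mul_one]
    congr 2
    omega
  rw [hnum, ← prod_pow_sub_pow, hflag] at hx
  rw [hIcc]
  apply mul_right_cancel₀ hA
  rw [hx]
  ring

/-- The blocks of rows of level at least `e / 2` contribute Gaussian binomial coefficients. -/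
theorem prod_upper_levels (hq : 1 < q) (e n : ℕ) (lam : ℕ → ℕ)
    (hlam : ∀ i ∈ Finset.Icc (e / 2 + 1) e, partialSum lam (e + 1 - i) + partialSum lam i ≤ n) :
    ∏ j ∈ Finset.Ico (e / 2 + e % 2) e, ∏ c ∈ Finset.range (lam (j + 1)),
        (q ^ (n - partialSum lam (e - j)) - q ^ (partialSum lam j + c)) /
          (q ^ partialSum lam (j + 1) - q ^ (partialSum lam j + c)) =
      ∏ a ∈ Finset.Icc (e / 2 + 1 + e % 2) e, gaussBinom q
        (lam a + n - partialSum lam a - partialSum lam (e + 1 - a)) (lam a) := by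
  have h1 : Finset.Icc (e / 2 + 1 + e % 2) e = Finset.Ico (e / 2 + e % 2 + 1) (e + 1) := by
    ext; simp only [Finset.mem_Icc, Finset.mem_Ico]; omega
  rw [h1, ← Finset.prod_Ico_add' (fun a => gaussBinom q
        (lam a + n - partialSum lam a - partialSum lam (e + 1 - a)) (lam a))]
  refine Finset.prod_congr rfl fun j hj => ?_
  rw [Finset.mem_Ico] at hj
  have h2 := hlam (j + 1) (Finset.mem_Icc.2 ⟨by omega, by omega⟩)
  rw [show e + 1 - (j + 1) = e - j by omega] at h2 ⊢
  rw [gaussBinom_shift hq _ _ (partialSum lam j)]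
  rw [partialSum_succ] at h2 ⊢
  rw [show lam (j + 1) + n - (partialSum lam j + lam (j + 1)) - partialSum lam (e - j) +
    partialSum lam j = n - partialSum lam (e - j) by omega, add_comm (lam (j + 1))]

theorem two_mul_sum_add_sum (lam : ℕ → ℕ) {e i : ℕ} (hi : e / 2 + 1 ≤ i) (hie : i ≤ e) :
    2 * ∑ j ∈ Finset.Icc 1 (e - i + 1), lam j + ∑ j ∈ Finset.Icc (e - i + 2) i, lam j =
      partialSum lam (e + 1 - i) + partialSum lam i := by
  have h1 : ∀ a b, Finset.Icc a b = Finset.Ico a (b + 1) := fun a b => by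
    ext; simp only [Finset.mem_Icc, Finset.mem_Ico]; omega
  have h2 := Finset.sum_Ico_consecutive lam (show 1 ≤ e - i + 2 by omega)
    (show e - i + 2 ≤ i + 1 by omega)
  rw [partialSum, partialSum, h1, h1, h1, h1, ← h2, show e + 1 - i + 1 = e - i + 2 by omega,
    show e - i + 1 + 1 = e - i + 2 by omega]
  ring

end Assembly
end ChainRingCodes

open ChainRingCodes in
theorem theorem4p3 {R : Type*} [CommRing R] [IsLocalRing R] (u : R) (e m κ : ℕ)
    (he : 4 ≤ e) (hκ : 2 ≤ κ) (hκe : κ ≤ e) (hκeven : Even κ)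
    (hR : IsEvenChainRing R u e m κ)
    (n : ℕ) (hn : Odd n) (lam : ℕ → ℕ)
    (hsum : partialSum lam (e + 1) = n)
    (hlam : ∀ i ∈ Finset.Icc (e / 2 + 1) e,
      2 * ∑ j ∈ Finset.Icc 1 (e - i + 1), lam j
        + ∑ j ∈ Finset.Icc (e - i + 2) i, lam j ≤ n) :
    (numSelfOrthogonal R u e n lam : ℚ)
        = ((2 : ℚ) ^ m) ^ formulaExponent e n κ lam
          * (numChains (IsLocalRing.ResidueField R) n lam (e / 2 + e % 2) (e / 2 - κ / 2) : ℚ)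
          * ∏ a ∈ Finset.Icc (e / 2 + 1 + e % 2) e,
              gaussBinom (2 ^ m)
                (lam a + n - partialSum lam a - partialSum lam (e + 1 - a)) (lam a) ∧
    (numChains (IsLocalRing.ResidueField R) n lam (e / 2 + e % 2) (e / 2 - κ / 2) : ℚ)
        = (∏ i ∈ Finset.range (partialSum lam (e / 2 + e % 2)),
              ((2 : ℚ) ^ (m * (n - 1 - 2 * i)) - 1) / ((2 : ℚ) ^ (m * (i + 1)) - 1))
          * ∏ j ∈ Finset.Icc 1 (e / 2 + e % 2),
              gaussBinom (2 ^ m) (partialSum lam j) (lam j) := by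
  have := hR.finite_residueField
  have h2 := hR.residue_two (by omega)
  have hlam' : ∀ i ∈ Finset.Icc (e / 2 + 1) e,
      partialSum lam (e + 1 - i) + partialSum lam i ≤ n := fun i hi => by
    have h := hlam i hi
    rw [Finset.mem_Icc] at hi
    rwa [two_mul_sum_add_sum lam hi.1 hi.2] at h
  have hq : (1 : ℚ) < 2 ^ m := by
    have h1 : 1 < Nat.card (IsLocalRing.ResidueField R) := Finite.one_lt_card
    rw [hR.card_residueField] at h1
    exact_mod_cast h1
  have hcard : (Nat.card (IsLocalRing.ResidueField R) : ℚ) = 2 ^ m := by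
    rw [hR.card_residueField]; push_cast; rfl
  have hN : partialSum lam e ≤ n := hsum ▸ partialSum_mono lam (Nat.le_succ e)
  obtain ⟨k, hk⟩ : ∃ k, k = e / 2 + e % 2 := ⟨_, rfl⟩
  have hk2 : 2 * partialSum lam k ≤ n := by
    have h1 := hlam' (e / 2 + 1) (Finset.mem_Icc.2 ⟨le_rfl, by omega⟩)
    have h3 := partialSum_mono lam (show k ≤ e + 1 - (e / 2 + 1) by omega)
    have h4 := partialSum_mono lam (show k ≤ e / 2 + 1 by omega)
    omega
  have hchains := numChains_mul (IsLocalRing.ResidueField R) h2 hn lam k (e / 2 - κ / 2)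
  rw [hcard] at hchains
  rw [← hk]
  refine ⟨?_, ?_⟩
  · generalize (numChains (IsLocalRing.ResidueField R) n lam k (e / 2 - κ / 2) : ℚ) = B at hchains ⊢
    have hmain := numSelfOrthogonal_mul hR hκ hκeven hn lam hN
    have hexp := sum_exponents e n κ (by omega) lam
    generalize (numSelfOrthogonal R u e n lam : ℚ) = M at hmain ⊢
    rw [← prod_upper_levels hq e n lam hlam', ← hk, ← hexp]
    generalize (2 : ℚ) ^ m = q at *
    have hq0 : q ≠ 0 := by positivity
    have hA : ∀ r ∈ Finset.range (partialSum lam e),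
        q ^ partialSum lam (blockIndex lam e r + 1) - q ^ r ≠ 0 := fun r hr =>
      pow_sub_pow_ne_zero hq (lt_partialSum_blockIndex lam (Finset.mem_range.1 hr))
    -- divide by the number of generator sequences of one code
    have hM : M = (∏ r ∈ Finset.range (partialSum lam e), reductionCount q e n lam r /
          (q ^ partialSum lam (blockIndex lam e r + 1) - q ^ r)) *
        ∏ r ∈ Finset.range (partialSum lam e), q ^ (liftExponent e n κ (blockIndex lam e) r -
          (colonExponent lam e n (blockIndex lam e r) : ℤ)) := by
      rw [← Finset.prod_mul_distrib]
      have hne : ∏ r ∈ Finset.range (partialSum lam e),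
          (q ^ partialSum lam (blockIndex lam e r + 1) - q ^ r) *
            q ^ colonExponent lam e n (blockIndex lam e r) ≠ 0 :=
        Finset.prod_ne_zero_iff.2 fun r hr => mul_ne_zero (hA r hr) (pow_ne_zero _ hq0)
      apply mul_right_cancel₀ hne
      rw [hmain, ← Finset.prod_mul_distrib]
      refine Finset.prod_congr rfl fun r hr => ?_
      have := hA r hr
      rw [zpow_sub₀ hq0, zpow_natCast]
      field_simp
    have hsplit : ∏ r ∈ Finset.range (partialSum lam e), reductionCount q e n lam r /
          (q ^ partialSum lam (blockIndex lam e r + 1) - q ^ r) =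
        B * ∏ j ∈ Finset.Ico k e, ∏ c ∈ Finset.range (lam (j + 1)),
          (q ^ (n - partialSum lam (e - j)) - q ^ (partialSum lam j + c)) /
            (q ^ partialSum lam (j + 1) - q ^ (partialSum lam j + c)) := by
      have h3 := prod_blocks lam e (fun j r => (if 2 * j < e then q ^ (n - 1 - r) - q ^ r
        else q ^ (n - partialSum lam (e - j)) - q ^ r) / (q ^ partialSum lam (j + 1) - q ^ r))
        (le_refl e)
      have h4 := prod_blocks lam k (fun j r => (q ^ (n - 1 - r) - q ^ r) /
        (q ^ partialSum lam (j + 1) - q ^ r)) (le_refl k)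
      rw [Finset.prod_div_distrib, ← hchains, mul_div_cancel_right₀] at h4
      · simp only [reductionCount]
        rw [h3, h4, Finset.range_eq_Ico, ← Finset.prod_Ico_consecutive _ (Nat.zero_le k)
          (show k ≤ e by omega), ← Finset.range_eq_Ico]
        congr 1
        · refine Finset.prod_congr rfl fun j hj => ?_
          rw [Finset.mem_range] at hj
          simp only [if_pos (show 2 * j < e by omega)]
        · refine Finset.prod_congr rfl fun j hj => ?_
          rw [Finset.mem_Ico] at hj
          simp only [if_neg (show ¬ 2 * j < e by omega)]
      · exact Finset.prod_ne_zero_iff.2 fun r hr =>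
          pow_sub_pow_ne_zero hq (lt_partialSum_blockIndex lam (Finset.mem_range.1 hr))
    have hzpow : ∀ (s : Finset ℕ) (f : ℕ → ℤ), ∏ r ∈ s, q ^ f r = q ^ ∑ r ∈ s, f r := by
      intro s f
      induction s using Finset.cons_induction with
      | empty => simp
      | cons a s ha ih => rw [Finset.prod_cons, Finset.sum_cons, zpow_add₀ hq0, ih]
    rw [hM, hsplit, hzpow]
    ring
  · rw [prod_flag_eq hq lam hk2 hchains]
    simp only [pow_mul]
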